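/- Fix a linearly ordered commutative ring $R$ of resources (for example $\mathbb Z$, $\mathbb Q$ or $\mathbb R$); $R_{\ge0}$ is the set of its nonnegative elements. Expressions are taken up to renaming of bound variables. **1. The calculus $\lambda_{\mathrm{amor}}^{\mathrm{na}}$.** *Terms*: $e::=x\mid\langle\rangle\mid i\ (i\in R)\mid e_1\,\mathrm{op}\,e_2\ (\mathrm{op}\in\{+,-,\times\})\mid\Lambda x.e\mid\lambda x.e\mid e_1\,e_2\mid\langle e_1,e_2\rangle\mid\pi_1e\mid\pi_2e\mid\mathrm{fix}\,x.e\mid\mathrm{tick}\,i\,e\mid\mathrm{let}\,x=e_1\,\mathrm{in}\,e_2\mid C_i(e_0,(e_1,\dots,e_m))\mid\mathrm{matd}(e,\{C_i(x_0,\dots,x_{m_i}).e_i\}_i)$. *Pre-values* $pv$: $x$, $\langle\rangle$, $i$, $\Lambda x.e$, $\lambda x.e$, and $\mathrm{op}$, pairs, constructors applied to pre-values. The lazy tick is $\mathrm{tick}^{\ell}\,c\,e:=(\lambda x.\,\mathrm{tick}\,c\,x)\,e$. *Types*: $T::=\mathrm{Unit}\mid\mathrm{int}\mid T_1\times T_2\mid\Pi_{x:[f_1]T_1}[f_2]_yT_2\mid\forall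 x{:}T_1.T_2\mid\mathrm{ind}(\{C_i(T_i,m_i)\}_i)$, where $C_i$ takes a content of type $T_i$ and $m_i$ components of the inductive type itself; in the arrow type $x$ is bound in $f_1,f_2,T_2$ and $y$ in $f_2,T_2$. Write $\mathrm{List}(T)=\mathrm{ind}(\{\mathrm{nil}(\mathrm{Unit},0),\mathrm{cons}(T,1)\})$, $T_1+T_2=\mathrm{ind}(\{\mathrm{left}(T_1,0),\mathrm{right}(T_2,0)\})$. *Potential functions*: $f::=c\ (c\in R)\mid a\mid f_1\,\mathrm{op}\,f_2\mid\mathrm{fix}\,f.\,\mathrm{matd}(a,\{C_i(x_0,\dots,x_{m_i}).\,b_i(x_0)+\sum_{j=1}^{m_i}s_{ij}(x_j,f\,x_j)\}_i)$, where $a$ is built from pre-values and projections $\pi_1,\pi_2$ (of type $\mathrm{int}$ in the second form). They denote elements of $R$, by primitive recursion on values, once their variables are instantiated by closed values (function values are not inspected). A *type context* $\Gamma$ and a *potential context* $\Omega$ are lists of declarations $x{:}T$; “$x$ fresh” means $x\notin\mathrm{dom}(\Omega)\cup\mathrm{dom}(\Gamma)$. $\Omega\mid\Gamma\vdash f$ (well-formedness)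 means that common variables of $\Omega$ and $\Gamma$ have the same type and $f$ is well typed over the variables of $\Omega,\Gamma$ (abstractions inside arguments $a$ need only have their free variables declared), where a product $f_1\times f_2$ needs disjoint sets of variables and the variables of the scrutinee $a$ of a recursion do not occur in its branches. $\Omega\mid\Gamma\vdash f\le g$ means that $f,g$ are well formed and that $f\le g$ holds in $R$ under every instantiation of the variables of $\Omega,\Gamma$ by closed values of their types; $f\equiv g$ means $f\le g$ and $g\le f$. *Typing* $\Omega\mid\Gamma\mid f_1\vdash e:[f_2]_xT$ is the least relation closed under the following rules. In each rule the bound variables named in it ($x$ in TFix, TPAbs, TLet; the distinct variables $x,y$ of the arrow type in TAbs and TApp; the pairwise distinct $x_0,\dots,x_{m_i}$ in TDes) are chosen fresh and free in none of the terms, types and potential functions outside their scope; in TApp and TLet, $x$ is then added to the potential context of the conclusion. (In TLet $y$ is any result binder.) - TTickp: $\Omega|\Gamma|f_1\vdash e:[f_2]_xT$, $p\ge0$ $\Rightarrow$ $\Omega|\Gamma|f_1+p\vdash\mathrm{tick}\,p\,e:[f_2]_xT$. - TTickn: $\Omega|\Gamma|f_1-p\vdash e:[f_2]_xT$, $p<0$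 $\Rightarrow$ $\Omega|\Gamma|f_1\vdash\mathrm{tick}\,p\,e:[f_2]_xT$. - TUnit, TInt: $\Omega|\Gamma|0\vdash\langle\rangle:[0]_x\mathrm{Unit}$ and $\Omega|\Gamma|0\vdash i:[0]_x\mathrm{int}$ for $x$ fresh. - TVar: $(x{:}T)\in\Gamma$ $\Rightarrow$ $\Omega|\Gamma|0\vdash x:[0]_xT$. - TDrop: $\Omega|\Gamma|f_1\vdash e:[f_2]_xT$ and $\Omega,x{:}T|\Gamma\vdash f_3\le f_2$ $\Rightarrow$ $\Omega|\Gamma|f_1\vdash e:[f_3]_xT$. - TRelax: $\Omega|\Gamma|f_1\vdash e:[f_2]_xT$ and $\Omega|\Gamma\vdash0\le f_3$ $\Rightarrow$ $\Omega|\Gamma|f_1+f_3\vdash e:[f_2+f_3]_xT$. - TConv: $\Omega|\Gamma|f_1\vdash e:[f_2]_xT$ and $\Omega|\Gamma\vdash f_1\equiv f_1'$ $\Rightarrow$ $\Omega|\Gamma|f_1'\vdash e:[f_2]_xT$. - TRename: $\Omega|\Gamma|f_1\vdash e:[f_2]_xT$, $y$ fresh $\Rightarrow$ $\Omega|\Gamma|f_1\vdash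 e:[f_2[x\mapsto y]]_y\,T[x\mapsto y]$. - TErase: $\Omega|\Gamma|f_1\vdash e:[f_2]_yT$, $x\in\mathrm{dom}(\Omega)$, $x$ not free in $f_1$ nor in the types of $\Omega\setminus x$ and $\Gamma$, and free in $f_2$ or $T$ only if $x=y$ $\Rightarrow$ $\Omega\setminus x|\Gamma|f_1\vdash e:[f_2]_yT$. - TFix: $\Omega|\Gamma,x{:}T|0\vdash e:[0]_yT$, $x\notin\mathrm{fv}(T)$, $z$ fresh $\Rightarrow$ $\Omega|\Gamma|0\vdash\mathrm{fix}\,x.e:[0]_zT$. - TPair: $\Omega|\Gamma|f_1\vdash e_1:[f_2]_{x_1}T_1$, $\Omega|\Gamma|f_3\vdash e_2:[f_4]_{x_2}T_2$, $x$ fresh $\Rightarrow$ $\Omega|\Gamma|f_1+f_3\vdash\langle e_1,e_2\rangle:[f_2[x_1\mapsto\pi_1x]+f_4[x_2\mapsto\pi_2x]]_x\,T_1\times T_2$. - TProj$_k$: $\Omega|\Gamma|f_1\vdash e:[f_2]_xT_1\times T_2$, $y$ fresh, $\Omega,y{:}T_k|\Gamma\vdash f_3$, $\Omega,x{:}T_1\times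 T_2|\Gamma\vdash f_3[y\mapsto\pi_kx]\le f_2$ $\Rightarrow$ $\Omega|\Gamma|f_1\vdash\pi_ke:[f_3]_yT_k$. - TPAbs: $\Omega|\Gamma,x{:}T_1|0\vdash e:[0]_yT_2$, $z$ fresh $\Rightarrow$ $\Omega|\Gamma|0\vdash\Lambda x.e:[0]_z\forall x{:}T_1.T_2$. - TPApp: $\Omega|\Gamma|f_1\vdash e:[f_2]_y\forall x{:}T_1.T_2$, $pv$ a pre-value, $\Omega|\Gamma|0\vdash pv:[0]_zT_1$, $\Omega|\Gamma\vdash f_2$, $w$ fresh $\Rightarrow$ $\Omega|\Gamma|f_1\vdash e\,pv:[f_2]_w\,T_2[x\mapsto pv]$. - TOp: $\Omega|\Gamma|f_1\vdash e_1:[f_2]_{x_1}\mathrm{int}$, $\Omega|\Gamma|f_3\vdash e_2:[f_4]_{x_2}\mathrm{int}$, $\Omega|\Gamma\vdash f_2+f_4$, $y$ fresh $\Rightarrow$ $\Omega|\Gamma|f_1+f_3\vdash e_1\,\mathrm{op}\,e_2:[f_2+f_4]_y\mathrm{int}$. - TAbs: $\Omega|\Gamma,x{:}T_1|f_1\vdash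 e:[f_2]_yT_2$, $z$ fresh $\Rightarrow$ $\Omega|\Gamma|0\vdash\lambda x.e:[0]_z\Pi_{x:[f_1]T_1}[f_2]_yT_2$. - TApp: $\Omega|\Gamma|f_1\vdash e_1:[f_2]_z\Pi_{x:[f_3]T_1}[f_4]_yT_2$, $\Omega|\Gamma|f_5\vdash e_2:[f_6]_wT_1$, $\Omega,x{:}T_1|\Gamma\vdash f_3[w\mapsto x]\le(f_2+f_6)[w\mapsto x]$ $\Rightarrow$ $\Omega,x{:}T_1|\Gamma|f_1+f_5\vdash e_1\,e_2:[(f_2+f_6-f_3)[w\mapsto x]+f_4]_yT_2$. - TLet: $\Omega|\Gamma|f_1\vdash e_1:[f_2]_zT_1$, $\Omega|\Gamma,x{:}T_1|f_3\vdash e_2:[f_4]_yT_2$, $\Omega|\Gamma,x{:}T_1\vdash f_3\le f_2[z\mapsto x]$ $\Rightarrow$ $\Omega,x{:}T_1|\Gamma|f_1\vdash\mathrm{let}\,x=e_1\,\mathrm{in}\,e_2:[f_2[z\mapsto x]-f_3+f_4]_yT_2$. - TCons, for $I=\mathrm{ind}(\{C_i(T_i,m_i)\}_i)$: $\Omega|\Gamma|f_1\vdash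 e_0:[f_2]_{x_0}T_i$, $\Omega|\Gamma|f_{3_j}\vdash e_j:[f_{4_j}]_{x_j}I$ for $1\le j\le m_i$, $y$ fresh, coinciding binders among $x_0,\dots,x_{m_i}$ being declared in $\Omega$ or $\Gamma$, $\Omega,y{:}I|\Gamma\vdash f_5$, $\Omega,x_0{:}T_i,x_1{:}I,\dots,x_{m_i}{:}I|\Gamma\vdash f_5[y\mapsto C_i(x_0,\dots,x_{m_i})]\le f_2+\sum_jf_{4_j}$ $\Rightarrow$ $\Omega|\Gamma|f_1+\sum_jf_{3_j}\vdash C_i(e_0,(e_1,\dots,e_{m_i})):[f_5]_yI$. - TDes: $\Omega|\Gamma|f_1\vdash e_0:[f_2]_xI$ and, for every $i$, $\Omega|\Gamma,x_0{:}T_i,x_1{:}I,\dots,x_{m_i}{:}I|f_2[x\mapsto C_i(x_0,\dots,x_{m_i})]\vdash e_i:[f_3]_yT$, where $x_0,\dots,x_{m_i}\notin\mathrm{fv}(f_3)\cup\mathrm{fv}(T)$ $\Rightarrow$ $\Omega|\Gamma|f_1\vdash\mathrm{matd}(e_0,\{C_i(x_0,\dots,x_{m_i}).e_i\}_i):[f_3]_yT$.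 **2. AARA.** Types: $A::=1\mid L^p(A)\mid A^p+B^r\mid A\times B\mid A\xrightarrow{p/q}B$ with annotations in $R_{\ge0}$. Expressions: $e::=x\mid\langle\rangle\mid\mathbf{let}\,x=e_1\,\mathbf{in}\,e_2\mid\mathbf{left}(e)\mid\mathbf{right}(e)\mid\mathbf{case}\,x\,\{\mathbf{left}(x_1)\mapsto e_1\mid\mathbf{right}(x_2)\mapsto e_2\}\mid\mathbf{nil}\mid\mathbf{cons}(x_1,x_2)\mid\mathbf{case}\,x\,\{\mathbf{nil}\mapsto e_0\mid\mathbf{cons}(x_1,x_2)\mapsto e_1\}\mid x_1(x_2)\mid\mathbf{fun}\,f\,x=e\mid\mathbf{tick}\,t\mid\mathbf{share}\,x\,\mathbf{as}\,x_1,x_2\,\mathbf{in}\,e$. A cost model consists of arbitrary constants $c_{Var},c_{Unit},c_{Let_1},c_{Let_2},c_{Let_3},c_{Left},c_{Right},c_{CaseLeft},c_{CaseRight},c_{Nil},c_{Cons},c_{CaseNil},c_{CaseCons},c_{App},c_{Fun}\in R$. Sharing $A\curlyveedownarrow(A_1,A_2)$ splits every annotation additively through $1,L^p(\cdot),\cdot^p+\cdot^r,\times$;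 an arrow type is shared only as itself, twice. For unordered contexts with distinct variables and $q,q'\in R_{\ge0}$ (as are all quantities named $p,p',r,r',s,s',s_i$), $\Gamma\vdash^q_{q'}e:A$ is the least relation closed under: - Var: $x{:}A\vdash^q_{q'}x:A$ if $q\ge q'+c_{Var}$. Unit: $\cdot\vdash^q_{q'}\langle\rangle:1$ if $q\ge q'+c_{Unit}$. Tick: $\cdot\vdash^q_{q'}\mathbf{tick}\,t:1$ if $q\ge q'+t$. Nil: $\cdot\vdash^q_{q'}\mathbf{nil}:L^p(A)$ if $q\ge q'+c_{Nil}$. Cons: $x_1{:}A,x_2{:}L^p(A)\vdash^q_{q'}\mathbf{cons}(x_1,x_2):L^p(A)$ if $q\ge q'+p+c_{Cons}$. - Let: $q\ge p+c_{Let_1}$, $\Gamma_1\vdash^p_{p'}e_1:A$, $p'\ge r+c_{Let_2}$, $\Gamma_2,x{:}A\vdash^r_{r'}e_2:B$, $r'\ge q'+c_{Let_3}$ $\Rightarrow$ $\Gamma_1,\Gamma_2\vdash^q_{q'}\mathbf{let}\,x=e_1\,\mathbf{in}\,e_2:B$. - Left: $q\ge s+c_{Left}$, $\Gamma\vdash^s_{s'}e:A$,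 $s'\ge q'+p$ $\Rightarrow$ $\Gamma\vdash^q_{q'}\mathbf{left}(e):A^p+B^r$. Right: $q\ge s+c_{Right}$, $\Gamma\vdash^s_{s'}e:B$, $s'\ge q'+r$ $\Rightarrow$ $\Gamma\vdash^q_{q'}\mathbf{right}(e):A^p+B^r$. - MatchSum: $q+p\ge s_1+c_{CaseLeft}$, $\Gamma,x_1{:}A\vdash^{s_1}_{q'}e_1:C$, $q+r\ge s_2+c_{CaseRight}$, $\Gamma,x_2{:}B\vdash^{s_2}_{q'}e_2:C$ $\Rightarrow$ $\Gamma,x{:}A^p+B^r\vdash^q_{q'}\mathbf{case}\,x\{\mathbf{left}(x_1)\mapsto e_1\mid\mathbf{right}(x_2)\mapsto e_2\}:C$. - MatchList: $q\ge s_0+c_{CaseNil}$, $\Gamma\vdash^{s_0}_{q'}e_0:B$, $q+p\ge s_1+c_{CaseCons}$, $\Gamma,x_1{:}A,x_2{:}L^p(A)\vdash^{s_1}_{q'}e_1:B$ $\Rightarrow$ $\Gamma,x{:}L^p(A)\vdash^q_{q'}\mathbf{case}\,x\{\mathbf{nil}\mapsto e_0\mid\mathbf{cons}(x_1,x_2)\mapsto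 e_1\}:B$. - App: $q\ge p+c_{App}$, $q-q'\ge p-p'+c_{App}$ $\Rightarrow$ $x_1{:}A\xrightarrow{p/p'}B,x_2{:}A\vdash^q_{q'}x_1(x_2):B$. - Fun: $C\curlyveedownarrow(C,C)$ for all types $C$ of $\Gamma$, $\Gamma,f{:}A\xrightarrow{p/p'}B,x{:}A\vdash^p_{p'}e:B$, $q\ge q'+c_{Fun}$ $\Rightarrow$ $\Gamma\vdash^q_{q'}\mathbf{fun}\,f\,x=e:A\xrightarrow{p/p'}B$. - Relax: $\Gamma\vdash^p_{p'}e:A$, $q\ge p$, $q-q'\ge p-p'$ $\Rightarrow$ $\Gamma\vdash^q_{q'}e:A$. Weak: $\Gamma\vdash^q_{q'}e:B$ $\Rightarrow$ $\Gamma,x{:}A\vdash^q_{q'}e:B$. - Share: $A\curlyveedownarrow(A_1,A_2)$, $\Gamma,x_1{:}A_1,x_2{:}A_2\vdash^q_{q'}e:B$ $\Rightarrow$ $\Gamma,x{:}A\vdash^q_{q'}\mathbf{share}\,x\,\mathbf{as}\,x_1,x_2\,\mathbf{in}\,e:B$. **3. Translation.** Types: $Type(1)=\mathrm{Unit}$,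 $Type(L^p(A))=\mathrm{List}(Type(A))$, $Type(A^p+B^r)=Type(A)+Type(B)$, $Type(A\times B)=Type(A)\times Type(B)$, $Type(A\xrightarrow{p/q}B)=\Pi_{x:[p+\Phi_x(A)]Type(A)}[q+\Phi_y(B)]_yType(B)$. Potentials of a term $a$: $\Phi_a(1)=0$, $\Phi_a(A\xrightarrow{p/q}B)=0$, $\Phi_a(A\times B)=\Phi_{\pi_1a}(A)+\Phi_{\pi_2a}(B)$, $\Phi_a(L^p(A))=\mathrm{fix}\,f.\mathrm{matd}(a,\{\mathrm{nil}.0,\ \mathrm{cons}(x_1,x_2).\Phi_{x_1}(A)+p+f\,x_2\})$, $\Phi_a(A^p+B^r)=\mathrm{fix}\,f.\mathrm{matd}(a,\{\mathrm{left}(x).\Phi_x(A)+p,\ \mathrm{right}(x).\Phi_x(B)+r\})$. Contexts: $Pure(\Gamma)=\{x{:}Type(A)\mid x{:}A\in\Gamma\}$ and $\Phi(\Gamma)=\sum_{x:A\in\Gamma}\Phi_x(A)$. Terms: - $h(x)=\mathrm{tick}\,c_{Var}\,x$; $h(\langle\rangle)=\mathrm{tick}\,c_{Unit}\,\langle\rangle$;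 $h(\mathbf{tick}\,t)=\mathrm{tick}\,t\,\langle\rangle$; $h(x_1(x_2))=\mathrm{tick}\,c_{App}\,(x_1\,x_2)$; - $h(\mathbf{let}\,x=e_1\,\mathbf{in}\,e_2)=\mathrm{tick}^{\ell}\,c_{Let_3}\,(\mathrm{let}\,x=\mathrm{tick}\,c_{Let_1}\,h(e_1)\,\mathrm{in}\,\mathrm{tick}\,c_{Let_2}\,h(e_2))$; - $h(\mathbf{left}(e))=\mathrm{tick}\,c_{Left}\,\mathrm{left}(h(e))$; $h(\mathbf{right}(e))=\mathrm{tick}\,c_{Right}\,\mathrm{right}(h(e))$; $h(\mathbf{nil})=\mathrm{tick}\,c_{Nil}\,\mathrm{nil}(\langle\rangle)$; $h(\mathbf{cons}(x_1,x_2))=\mathrm{tick}\,c_{Cons}\,\mathrm{cons}(x_1,x_2)$; - $h(\mathbf{case}\,x\{\mathbf{left}(x_1)\mapsto e_1\mid\mathbf{right}(x_2)\mapsto e_2\})=\mathrm{matd}(x,\{\mathrm{left}(x_1).\mathrm{tick}\,c_{CaseLeft}\,h(e_1),\ \mathrm{right}(x_2).\mathrm{tick}\,c_{CaseRight}\,h(e_2)\})$;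 - $h(\mathbf{case}\,x\{\mathbf{nil}\mapsto e_0\mid\mathbf{cons}(x_1,x_2)\mapsto e_1\})=\mathrm{matd}(x,\{\mathrm{nil}.\mathrm{tick}\,c_{CaseNil}\,h(e_0),\ \mathrm{cons}(x_1,x_2).\mathrm{tick}\,c_{CaseCons}\,h(e_1)\})$; - $h(\mathbf{fun}\,f\,x=e)=\mathrm{tick}\,c_{Fun}\,(\mathrm{fix}\,f.\lambda x.h(e))$; $h(\mathbf{share}\,x\,\mathbf{as}\,x_1,x_2\,\mathbf{in}\,e)=h(e[x_1\mapsto x,x_2\mapsto x])$. **Theorem (AARA embedding).** Let $\Gamma\vdash^p_qe:A$ be derivable in AARA for some cost model, and let $x\notin\mathrm{dom}(\Gamma)$. Then there is a potential function $\Phi'_x(A)$ such that $$x{:}Type(A)\mid Pure(\Gamma)\vdash q+\Phi_x(A)\le\Phi'_x(A)\qquad\text{and}\qquad\cdot\mid Pure(\Gamma)\mid\Phi(\Gamma)+p\vdash h(e):[\Phi'_x(A)]_x\,Type(A).$$ -/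

import Mathlib

namespace AmorNA

/-! ## Variables

Terms are locally nameless: a variable is a de Bruijn index (bound in the term) or a name (free,
declared in a context).  This makes terms literally equal when they are alpha-equivalent. -/

/-- Nonnegative elements of the resource domain. -/
abbrev NN (R : Type*) [CommRing R] [LinearOrder R] := {r : R // 0 ≤ r}

inductive Var where
  | bound (n : ℕ)
  | free (x : ℕ)

/-- Weakening of the dangling indices by `k`. -/
def Var.shift (k : ℕ) : Var → Var
  | .bound n => .bound (n + k)
  | .free x => .free x

/-- Replacement of the dangling indices by variables. -/
def Var.ren (ξ : ℕ → Var) : Var → Var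
  | .bound n => ξ n
  | .free x => .free x

def Var.fv : Var → Finset ℕ
  | .bound _ => ∅
  | .free x => {x}

/-- A replacement of indices, carried under `k` binders. -/
def lift (k : ℕ) (ξ : ℕ → Var) : ℕ → Var :=
  fun n => if n < k then .bound n else (ξ (n - k)).shift k

/-- Opening of `xs.length` binders: index `i` becomes the name `xs[i]`. -/
def openWith (xs : List ℕ) : ℕ → Var :=
  fun n => match xs[n]? with
    | some x => .free x
    | none => .bound (n - xs.length)

/-- The domain of a context. -/
def dom {T : Type*} (Γ : List (ℕ × T)) : List ℕ := Γ.map Prod.fst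

/-! ## The calculus `λ_amor^na`: terms, potential functions, types -/

inductive Op where
  | add
  | sub
  | mul

def Op.eval {R : Type*} [CommRing R] : Op → R → R → R
  | .add, a, b => a + b
  | .sub, a, b => a - b
  | .mul, a, b => a * b

/-- Terms, without type annotations.  `lam`, `tlam` (the potential abstraction `Λ`) and `fix` bind
one variable, `letE` binds one in its second component.  `con i e₀ m es` is the constructor
`C_i(e₀,(e_1,…,e_m))`.  In `case e n m br`, that is `matd(e,{C_i(x_0,…,x_{m_i}).br_i})`, the branch
`br i` binds `1 + m i` variables, `x_j` being index `j`. -/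
inductive Tm (R : Type*) where
  | var (v : Var)
  | unit
  | int (i : R)
  | op (o : Op) (e₁ e₂ : Tm R)
  | tlam (e : Tm R)
  | lam (e : Tm R)
  | app (e₁ e₂ : Tm R)
  | pair (e₁ e₂ : Tm R)
  | fst (e : Tm R)
  | snd (e : Tm R)
  | fix (e : Tm R)
  | tick (i : R) (e : Tm R)
  | letE (e₁ e₂ : Tm R)
  | con (i : ℕ) (e₀ : Tm R) (m : ℕ) (es : Fin m → Tm R)
  | case (e : Tm R) (n : ℕ) (m : Fin n → ℕ) (br : Fin n → Tm R)

/-- Replacement of dangling indices by variables. -/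
def Tm.ren {R : Type*} : (ℕ → Var) → Tm R → Tm R
  | ξ, .var v => .var (v.ren ξ)
  | _, .unit => .unit
  | _, .int i => .int i
  | ξ, .op o e₁ e₂ => .op o (e₁.ren ξ) (e₂.ren ξ)
  | ξ, .tlam e => .tlam (e.ren (lift 1 ξ))
  | ξ, .lam e => .lam (e.ren (lift 1 ξ))
  | ξ, .app e₁ e₂ => .app (e₁.ren ξ) (e₂.ren ξ)
  | ξ, .pair e₁ e₂ => .pair (e₁.ren ξ) (e₂.ren ξ)
  | ξ, .fst e => .fst (e.ren ξ)
  | ξ, .snd e => .snd (e.ren ξ)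
  | ξ, .fix e => .fix (e.ren (lift 1 ξ))
  | ξ, .tick i e => .tick i (e.ren ξ)
  | ξ, .letE e₁ e₂ => .letE (e₁.ren ξ) (e₂.ren (lift 1 ξ))
  | ξ, .con i e₀ m es => .con i (e₀.ren ξ) m (fun j => (es j).ren ξ)
  | ξ, .case e n m br => .case (e.ren ξ) n m (fun i => (br i).ren (lift (1 + m i) ξ))

/-- Substitution of a term without dangling indices for a name. -/
def Tm.subst {R : Type*} : Tm R → ℕ → Tm R → Tm R
  | .var (.bound n), _, _ => .var (.bound n)
  | .var (.free y), x, u => if y = x then u else .var (.free y)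
  | .unit, _, _ => .unit
  | .int i, _, _ => .int i
  | .op o e₁ e₂, x, u => .op o (e₁.subst x u) (e₂.subst x u)
  | .tlam e, x, u => .tlam (e.subst x u)
  | .lam e, x, u => .lam (e.subst x u)
  | .app e₁ e₂, x, u => .app (e₁.subst x u) (e₂.subst x u)
  | .pair e₁ e₂, x, u => .pair (e₁.subst x u) (e₂.subst x u)
  | .fst e, x, u => .fst (e.subst x u)
  | .snd e, x, u => .snd (e.subst x u)
  | .fix e, x, u => .fix (e.subst x u)
  | .tick i e, x, u => .tick i (e.subst x u)
  | .letE e₁ e₂, x, u => .letE (e₁.subst x u) (e₂.subst x u)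
  | .con i e₀ m es, x, u => .con i (e₀.subst x u) m (fun j => (es j).subst x u)
  | .case e n m br, x, u => .case (e.subst x u) n m (fun i => (br i).subst x u)

/-- Free names. -/
def Tm.fv {R : Type*} : Tm R → Finset ℕ
  | .var v => v.fv
  | .unit => ∅
  | .int _ => ∅
  | .op _ e₁ e₂ => e₁.fv ∪ e₂.fv
  | .tlam e => e.fv
  | .lam e => e.fv
  | .app e₁ e₂ => e₁.fv ∪ e₂.fv
  | .pair e₁ e₂ => e₁.fv ∪ e₂.fv
  | .fst e => e.fv
  | .snd e => e.fv
  | .fix e => e.fv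
  | .tick _ e => e.fv
  | .letE e₁ e₂ => e₁.fv ∪ e₂.fv
  | .con _ e₀ _ es => e₀.fv ∪ Finset.univ.biUnion (fun j => (es j).fv)
  | .case e _ _ br => e.fv ∪ Finset.univ.biUnion (fun i => (br i).fv)

/-- Pre-values. -/
def Tm.IsPreValue {R : Type*} : Tm R → Prop
  | .var _ => True
  | .unit => True
  | .int _ => True
  | .op _ e₁ e₂ => e₁.IsPreValue ∧ e₂.IsPreValue
  | .tlam _ => True
  | .lam _ => True
  | .pair e₁ e₂ => e₁.IsPreValue ∧ e₂.IsPreValue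
  | .con _ e₀ _ es => e₀.IsPreValue ∧ ∀ j, (es j).IsPreValue
  | _ => False

/-- Potential functions.  `val a` is the value of an integer-typed pre-value `a`; the argument `a`
of `val` and `prec` may also contain the projections `π₁`, `π₂`.
`prec a n m b s` is the primitive recursion
`fix f. matd(a, {C_i(x_0,…,x_{m_i}). b_i(x_0) + ∑_{j=1}^{m_i} s_{ij}(x_j, f x_j)})`:
`b i` binds `x_0` (index `0`), and `s i j` binds the component (index `0`) and the value of the
recursive call on it (index `1`, an integer). -/
inductive Pot (R : Type*) where
  | const (c : R)
  | val (a : Tm R)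
  | op (o : Op) (f g : Pot R)
  | prec (a : Tm R) (n : ℕ) (m : Fin n → ℕ) (b : Fin n → Pot R) (s : (i : Fin n) → Fin (m i) → Pot R)

namespace Pot

def add {R : Type*} (f g : Pot R) : Pot R := .op .add f g

def sub {R : Type*} (f g : Pot R) : Pot R := .op .sub f g

def zero {R : Type*} [CommRing R] : Pot R := .const 0

/-- `f 0 + (f 1 + (… + 0))`. -/
def sum {R : Type*} [CommRing R] {m : ℕ} (f : Fin m → Pot R) : Pot R :=
  (List.ofFn f).foldr add zero

def ren {R : Type*} : (ℕ → Var) → Pot R → Pot R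
  | _, .const c => .const c
  | ξ, .val a => .val (a.ren ξ)
  | ξ, .op o f g => .op o (f.ren ξ) (g.ren ξ)
  | ξ, .prec a n m b s => .prec (a.ren ξ) n m (fun i => (b i).ren (lift 1 ξ))
      (fun i j => (s i j).ren (lift 2 ξ))

def subst {R : Type*} (x : ℕ) (u : Tm R) : Pot R → Pot R
  | .const c => .const c
  | .val a => .val (a.subst x u)
  | .op o f g => .op o (f.subst x u) (g.subst x u)
  | .prec a n m b s => .prec (a.subst x u) n m (fun i => (b i).subst x u)
      (fun i j => (s i j).subst x u)

def fv {R : Type*} : Pot R → Finset ℕ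
  | .const _ => ∅
  | .val a => a.fv
  | .op _ f g => f.fv ∪ g.fv
  | .prec a _ _ b s => a.fv ∪ Finset.univ.biUnion (fun i => (b i).fv) ∪
      Finset.univ.biUnion (fun i => Finset.univ.biUnion (fun j => (s i j).fv))

end Pot

/-- Types.  `arrow T₁ f₁ T₂ f₂` is `Π_{x:[f₁]T₁}[f₂]_y T₂`: in `f₁` index `0` is `x`; in `T₂` and
`f₂` index `0` is `y` and index `1` is `x`.  `poly T₁ T₂` is `∀x:T₁. T₂`.
`ind n T m` is the inductive type with constructors `C_i` (`i < n`), whose content has type `T i` and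
which take `m i` components of the inductive type itself. -/
inductive Ty (R : Type*) where
  | unit
  | int
  | prod (T₁ T₂ : Ty R)
  | arrow (T₁ : Ty R) (f₁ : Pot R) (T₂ : Ty R) (f₂ : Pot R)
  | poly (T₁ T₂ : Ty R)
  | ind (n : ℕ) (T : Fin n → Ty R) (m : Fin n → ℕ)

namespace Ty

def ren {R : Type*} : (ℕ → Var) → Ty R → Ty R
  | _, .unit => .unit
  | _, .int => .int
  | ξ, .prod T₁ T₂ => .prod (T₁.ren ξ) (T₂.ren ξ)
  | ξ, .arrow T₁ f₁ T₂ f₂ =>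
      .arrow (T₁.ren ξ) (f₁.ren (lift 1 ξ)) (T₂.ren (lift 2 ξ)) (f₂.ren (lift 2 ξ))
  | ξ, .poly T₁ T₂ => .poly (T₁.ren ξ) (T₂.ren (lift 1 ξ))
  | ξ, .ind n T m => .ind n (fun i => (T i).ren ξ) m

def subst {R : Type*} (x : ℕ) (u : Tm R) : Ty R → Ty R
  | .unit => .unit
  | .int => .int
  | .prod T₁ T₂ => .prod (T₁.subst x u) (T₂.subst x u)
  | .arrow T₁ f₁ T₂ f₂ =>
      .arrow (T₁.subst x u) (f₁.subst x u) (T₂.subst x u) (f₂.subst x u)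
  | .poly T₁ T₂ => .poly (T₁.subst x u) (T₂.subst x u)
  | .ind n T m => .ind n (fun i => (T i).subst x u) m

def fv {R : Type*} : Ty R → Finset ℕ
  | .unit => ∅
  | .int => ∅
  | .prod T₁ T₂ => T₁.fv ∪ T₂.fv
  | .arrow T₁ f₁ T₂ f₂ => T₁.fv ∪ f₁.fv ∪ T₂.fv ∪ f₂.fv
  | .poly T₁ T₂ => T₁.fv ∪ T₂.fv
  | .ind _ T _ => Finset.univ.biUnion (fun i => (T i).fv)

end Ty

/-- Type contexts `Γ` and potential contexts `Ω`. -/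
abbrev Ctx (R : Type*) := List (ℕ × Ty R)

/-- `x` occurs free in a type of the context. -/
def Ctx.Occurs {R : Type*} (x : ℕ) (Γ : Ctx R) : Prop := ∃ y T, (y, T) ∈ Γ ∧ x ∈ T.fv

/-- `Ω \ x`. -/
def Ctx.erase {R : Type*} (Ω : Ctx R) (x : ℕ) : Ctx R := Ω.filter (fun b => b.1 ≠ x)

/-- `Δ` without the variables in `s`. -/
def Ctx.without {R : Type*} (Δ : Ctx R) (s : Finset ℕ) : Ctx R := Δ.filter (fun b => b.1 ∉ s)

/-! ## Semantics of potential functions -/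

/-- Closed values.  Potential functions do not depend on function values, hence all abstractions are
represented by the one token `fn`. -/
inductive Val (R : Type*) where
  | unit
  | int (i : R)
  | pair (v₁ v₂ : Val R)
  | con (i : ℕ) (v₀ : Val R) (m : ℕ) (vs : Fin m → Val R)
  | fn

/-- The values of a type. -/
inductive Val.HasType {R : Type*} : Val R → Ty R → Prop
  | unit : HasType .unit .unit
  | int (i : R) : HasType (.int i) .int
  | pair {v₁ v₂ : Val R} {T₁ T₂ : Ty R} : HasType v₁ T₁ → HasType v₂ T₂ →
      HasType (.pair v₁ v₂) (.prod T₁ T₂)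
  | con {n : ℕ} {T : Fin n → Ty R} {m : Fin n → ℕ} (i : Fin n) {v₀ : Val R}
      {vs : Fin (m i) → Val R} : HasType v₀ (T i) → (∀ j, HasType (vs j) (.ind n T m)) →
      HasType (.con i v₀ (m i) vs) (.ind n T m)
  | arrow (T₁ : Ty R) (f₁ : Pot R) (T₂ : Ty R) (f₂ : Pot R) : HasType .fn (.arrow T₁ f₁ T₂ f₂)
  | poly (T₁ T₂ : Ty R) : HasType .fn (.poly T₁ T₂)

def Val.toInt {R : Type*} [CommRing R] : Val R → R
  | .int i => i
  | _ => 0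

def Val.proj₁ {R : Type*} : Val R → Val R
  | .pair v₁ _ => v₁
  | _ => .unit

def Val.proj₂ {R : Type*} : Val R → Val R
  | .pair _ v₂ => v₂
  | _ => .unit

/-- Primitive recursion over a value: `C_i(v_0,…,v_m)` is sent to
`B i v_0 + ∑_j S i j v_j (fold v_j)`. -/
def Val.fold {R : Type*} [CommRing R] (B : ℕ → Val R → R) (S : ℕ → ℕ → Val R → R → R) : Val R → R
  | .con i v₀ m vs => B i v₀ + ∑ j : Fin m, S i j (vs j) (Val.fold B S (vs j))
  | _ => 0

/-- The value of an argument of a potential function, for an instantiation `ρ` of the names and `σ`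
of the indices.  Terms other than pre-values and projections do not occur in well-formed potential
functions. -/
def Tm.eval {R : Type*} [CommRing R] (ρ : ℕ → Val R) (σ : List (Val R)) : Tm R → Val R
  | .var (.bound n) => σ.getD n .unit
  | .var (.free x) => ρ x
  | .unit => .unit
  | .int i => .int i
  | .op o e₁ e₂ => .int (o.eval (e₁.eval ρ σ).toInt (e₂.eval ρ σ).toInt)
  | .tlam _ => .fn
  | .lam _ => .fn
  | .pair e₁ e₂ => .pair (e₁.eval ρ σ) (e₂.eval ρ σ)
  | .fst e => (e.eval ρ σ).proj₁
  | .snd e => (e.eval ρ σ).proj₂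
  | .con i e₀ m es => .con i (e₀.eval ρ σ) m (fun j => (es j).eval ρ σ)
  | _ => .unit

/-- The value of a potential function. -/
def Pot.eval {R : Type*} [CommRing R] (ρ : ℕ → Val R) : List (Val R) → Pot R → R
  | _, .const c => c
  | σ, .val a => (a.eval ρ σ).toInt
  | σ, .op o f g => o.eval (f.eval ρ σ) (g.eval ρ σ)
  | σ, .prec a n m b s =>
      Val.fold
        (fun i v => if h : i < n then (b ⟨i, h⟩).eval ρ (v :: σ) else 0)
        (fun i j v r => if h : i < n then
          (if h' : j < m ⟨i, h⟩ then (s ⟨i, h⟩ ⟨j, h'⟩).eval ρ (v :: .int r :: σ) else 0) else 0)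
        (a.eval ρ σ)

/-! ## Well-formedness of potential functions and the inequality judgement -/

/-- Typing of the arguments of potential functions (pre-values and projections). -/
inductive ArgTy {R : Type*} (Δ : Ctx R) : Tm R → Ty R → Prop
  | var {x : ℕ} {T : Ty R} : (x, T) ∈ Δ → ArgTy Δ (.var (.free x)) T
  | unit : ArgTy Δ .unit .unit
  | int (i : R) : ArgTy Δ (.int i) .int
  | op (o : Op) {a₁ a₂ : Tm R} : ArgTy Δ a₁ .int → ArgTy Δ a₂ .int → ArgTy Δ (.op o a₁ a₂) .int
  | pair {a₁ a₂ : Tm R} {T₁ T₂ : Ty R} : ArgTy Δ a₁ T₁ → ArgTy Δ a₂ T₂ →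
      ArgTy Δ (.pair a₁ a₂) (.prod T₁ T₂)
  | fst {a : Tm R} {T₁ T₂ : Ty R} : ArgTy Δ a (.prod T₁ T₂) → ArgTy Δ (.fst a) T₁
  | snd {a : Tm R} {T₁ T₂ : Ty R} : ArgTy Δ a (.prod T₁ T₂) → ArgTy Δ (.snd a) T₂
  | con {n : ℕ} {T : Fin n → Ty R} {m : Fin n → ℕ} (i : Fin n) {a₀ : Tm R}
      {as : Fin (m i) → Tm R} : ArgTy Δ a₀ (T i) → (∀ j, ArgTy Δ (as j) (.ind n T m)) →
      ArgTy Δ (.con i a₀ (m i) as) (.ind n T m)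
  | lam {e : Tm R} (T₁ : Ty R) (f₁ : Pot R) (T₂ : Ty R) (f₂ : Pot R) :
      (∀ x ∈ e.fv, x ∈ dom Δ) → ArgTy Δ (.lam e) (.arrow T₁ f₁ T₂ f₂)
  | tlam {e : Tm R} (T₁ T₂ : Ty R) : (∀ x ∈ e.fv, x ∈ dom Δ) → ArgTy Δ (.tlam e) (.poly T₁ T₂)

/-- Well-formed potential functions over the variables of `Δ`.  Addition and subtraction are the
linear operations; the non-linear multiplication requires arguments over disjoint sets of variables.
The scrutinee of a recursion is not available in its branches. -/
inductive PotOk {R : Type*} : Ctx R → Pot R → Prop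
  | const (Δ : Ctx R) (c : R) : PotOk Δ (.const c)
  | val {Δ : Ctx R} {a : Tm R} : ArgTy Δ a .int → PotOk Δ (.val a)
  | add {Δ : Ctx R} {f g : Pot R} : PotOk Δ f → PotOk Δ g → PotOk Δ (.op .add f g)
  | sub {Δ : Ctx R} {f g : Pot R} : PotOk Δ f → PotOk Δ g → PotOk Δ (.op .sub f g)
  | mul {Δ : Ctx R} {f g : Pot R} : PotOk Δ f → PotOk Δ g → Disjoint f.fv g.fv →
      PotOk Δ (.op .mul f g)
  | prec {Δ : Ctx R} {a : Tm R} {n : ℕ} {T : Fin n → Ty R} {m : Fin n → ℕ} {b : Fin n → Pot R}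
      {s : (i : Fin n) → Fin (m i) → Pot R} :
      ArgTy Δ a (.ind n T m) →
      (∀ i x, x ∉ dom Δ → x ∉ (b i).fv →
        PotOk ((x, T i) :: Δ.without a.fv) ((b i).ren (openWith [x]))) →
      (∀ i j x r, x ≠ r → x ∉ dom Δ → r ∉ dom Δ → x ∉ (s i j).fv → r ∉ (s i j).fv →
        PotOk ((x, .ind n T m) :: (r, .int) :: Δ.without a.fv) ((s i j).ren (openWith [x, r]))) →
      PotOk Δ (.prec a n m b s)

/-- `Ω | Γ ⊢ f`: common variables of the two contexts have the same type, and `f` is well formed over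
both contexts. -/
def PotWf {R : Type*} (Ω Γ : Ctx R) (f : Pot R) : Prop :=
  (∀ x T T', (x, T) ∈ Ω → (x, T') ∈ Γ → T = T') ∧ PotOk (Ω ++ Γ) f

/-- `ρ` instantiates each variable of `Δ` by a value of its type. -/
def Inst {R : Type*} (Δ : Ctx R) (ρ : ℕ → Val R) : Prop := ∀ x T, (x, T) ∈ Δ → (ρ x).HasType T

/-- `Ω | Γ ⊢ f ≤ g`. -/
def PotLe {R : Type*} [CommRing R] [LinearOrder R] (Ω Γ : Ctx R) (f g : Pot R) : Prop :=
  PotWf Ω Γ f ∧ PotWf Ω Γ g ∧ ∀ ρ, Inst (Ω ++ Γ) ρ → f.eval ρ [] ≤ g.eval ρ []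

/-! ## Typing of `λ_amor^na` -/

/-- A name that is declared in neither context. -/
def Fresh {R : Type*} (x : ℕ) (Ω Γ : Ctx R) : Prop := x ∉ dom Ω ∧ x ∉ dom Γ

/-- A free variable as a term. -/
abbrev Tm.name {R : Type*} (x : ℕ) : Tm R := .var (.free x)

/-- `HasTy Ω Γ f₁ e x f₂ T` is the judgement `Ω | Γ | f₁ ⊢ e : [f₂]_x T`. -/
inductive HasTy {R : Type*} [CommRing R] [LinearOrder R] :
    Ctx R → Ctx R → Pot R → Tm R → ℕ → Pot R → Ty R → Prop
  | tickp {Ω Γ : Ctx R} {f₁ f₂ : Pot R} {e : Tm R} {x : ℕ} {T : Ty R} {p : R} :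
      HasTy Ω Γ f₁ e x f₂ T → 0 ≤ p →
      HasTy Ω Γ (f₁.add (.const p)) (.tick p e) x f₂ T
  | tickn {Ω Γ : Ctx R} {f₁ f₂ : Pot R} {e : Tm R} {x : ℕ} {T : Ty R} {p : R} :
      HasTy Ω Γ (f₁.sub (.const p)) e x f₂ T → p < 0 →
      HasTy Ω Γ f₁ (.tick p e) x f₂ T
  | unit {Ω Γ : Ctx R} {x : ℕ} : Fresh x Ω Γ → HasTy Ω Γ .zero .unit x .zero .unit
  | int {Ω Γ : Ctx R} {x : ℕ} (i : R) : Fresh x Ω Γ → HasTy Ω Γ .zero (.int i) x .zero .int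
  | drop {Ω Γ : Ctx R} {f₁ f₂ f₃ : Pot R} {e : Tm R} {x : ℕ} {T : Ty R} :
      HasTy Ω Γ f₁ e x f₂ T → PotLe ((x, T) :: Ω) Γ f₃ f₂ →
      HasTy Ω Γ f₁ e x f₃ T
  | fix {Ω Γ : Ctx R} {e : Tm R} {x y z : ℕ} {T : Ty R} :
      Fresh z Ω Γ → Fresh x Ω Γ → x ∉ e.fv → x ∉ T.fv →
      HasTy Ω ((x, T) :: Γ) .zero (e.ren (openWith [x])) y .zero T →
      HasTy Ω Γ .zero (.fix e) z .zero T
  | rename {Ω Γ : Ctx R} {f₁ f₂ : Pot R} {e : Tm R} {x y : ℕ} {T : Ty R} :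
      Fresh y Ω Γ → HasTy Ω Γ f₁ e x f₂ T →
      HasTy Ω Γ f₁ e y (f₂.subst x (.name y)) (T.subst x (.name y))
  | proj₁ {Ω Γ : Ctx R} {f₁ f₂ f₃ : Pot R} {e : Tm R} {x y : ℕ} {T₁ T₂ : Ty R} :
      Fresh y Ω Γ → HasTy Ω Γ f₁ e x f₂ (.prod T₁ T₂) →
      PotWf ((y, T₁) :: Ω) Γ f₃ →
      PotLe ((x, .prod T₁ T₂) :: Ω) Γ (f₃.subst y (.fst (.name x))) f₂ →
      HasTy Ω Γ f₁ (.fst e) y f₃ T₁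
  | proj₂ {Ω Γ : Ctx R} {f₁ f₂ f₃ : Pot R} {e : Tm R} {x y : ℕ} {T₁ T₂ : Ty R} :
      Fresh y Ω Γ → HasTy Ω Γ f₁ e x f₂ (.prod T₁ T₂) →
      PotWf ((y, T₂) :: Ω) Γ f₃ →
      PotLe ((x, .prod T₁ T₂) :: Ω) Γ (f₃.subst y (.snd (.name x))) f₂ →
      HasTy Ω Γ f₁ (.snd e) y f₃ T₂
  | var {Ω Γ : Ctx R} {x : ℕ} {T : Ty R} :
      (x, T) ∈ Γ → HasTy Ω Γ .zero (.name x) x .zero T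
  | relax {Ω Γ : Ctx R} {f₁ f₂ f₃ : Pot R} {e : Tm R} {x : ℕ} {T : Ty R} :
      HasTy Ω Γ f₁ e x f₂ T → PotLe Ω Γ .zero f₃ →
      HasTy Ω Γ (f₁.add f₃) e x (f₂.add f₃) T
  | pair {Ω Γ : Ctx R} {f₁ f₂ f₃ f₄ : Pot R} {e₁ e₂ : Tm R} {x x₁ x₂ : ℕ} {T₁ T₂ : Ty R} :
      HasTy Ω Γ f₁ e₁ x₁ f₂ T₁ → HasTy Ω Γ f₃ e₂ x₂ f₄ T₂ → Fresh x Ω Γ →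
      HasTy Ω Γ (f₁.add f₃) (.pair e₁ e₂) x
        ((f₂.subst x₁ (.fst (.name x))).add (f₄.subst x₂ (.snd (.name x)))) (.prod T₁ T₂)
  | erase {Ω Γ : Ctx R} {f₁ f₂ : Pot R} {e : Tm R} {x y : ℕ} {T T' : Ty R} :
      HasTy Ω Γ f₁ e y f₂ T → (x, T') ∈ Ω → ¬ Ctx.Occurs x (Ω.erase x) → ¬ Ctx.Occurs x Γ →
      x ∉ f₁.fv → (x ∈ f₂.fv → x = y) → (x ∈ T.fv → x = y) →
      HasTy (Ω.erase x) Γ f₁ e y f₂ T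
  | pabs {Ω Γ : Ctx R} {e : Tm R} {x y z : ℕ} {T₁ T₂ : Ty R} :
      Fresh z Ω Γ → Fresh x Ω Γ → x ∉ e.fv → x ∉ T₂.fv →
      HasTy Ω ((x, T₁) :: Γ) .zero (e.ren (openWith [x])) y .zero (T₂.ren (openWith [x])) →
      HasTy Ω Γ .zero (.tlam e) z .zero (.poly T₁ T₂)
  | papp {Ω Γ : Ctx R} {f₁ f₂ : Pot R} {e pv : Tm R} {x y z w : ℕ} {T₁ T₂ : Ty R} :
      HasTy Ω Γ f₁ e y f₂ (.poly T₁ T₂) → pv.IsPreValue →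
      HasTy Ω Γ .zero pv z .zero T₁ → PotWf Ω Γ f₂ → Fresh w Ω Γ → x ∉ T₂.fv →
      HasTy Ω Γ f₁ (.app e pv) w f₂ ((T₂.ren (openWith [x])).subst x pv)
  | op {Ω Γ : Ctx R} {f₁ f₂ f₃ f₄ : Pot R} {e₁ e₂ : Tm R} {x₁ x₂ y : ℕ} (o : Op) :
      Fresh y Ω Γ → HasTy Ω Γ f₁ e₁ x₁ f₂ .int → HasTy Ω Γ f₃ e₂ x₂ f₄ .int →
      PotWf Ω Γ (f₂.add f₄) →
      HasTy Ω Γ (f₁.add f₃) (.op o e₁ e₂) y (f₂.add f₄) .int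
  | abs {Ω Γ : Ctx R} {f₁ f₂ : Pot R} {e : Tm R} {x y z : ℕ} {T₁ T₂ : Ty R} :
      Fresh x Ω Γ → Fresh y Ω Γ → x ≠ y → x ∉ e.fv →
      x ∉ f₁.fv ∪ f₂.fv ∪ T₂.fv → y ∉ f₂.fv ∪ T₂.fv →
      HasTy Ω ((x, T₁) :: Γ) (f₁.ren (openWith [x])) (e.ren (openWith [x])) y
        (f₂.ren (openWith [y, x])) (T₂.ren (openWith [y, x])) →
      Fresh z Ω Γ →
      HasTy Ω Γ .zero (.lam e) z .zero (.arrow T₁ f₁ T₂ f₂)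
  | app {Ω Γ : Ctx R} {f₁ f₂ f₃ f₄ f₅ f₆ : Pot R} {e₁ e₂ : Tm R} {x y z w : ℕ} {T₁ T₂ : Ty R} :
      Fresh x Ω Γ → Fresh y Ω Γ → x ≠ y → x ∉ f₂.fv ∪ f₃.fv ∪ f₄.fv ∪ T₂.fv → y ∉ f₄.fv ∪ T₂.fv →
      HasTy Ω Γ f₁ e₁ z f₂ (.arrow T₁ f₃ T₂ f₄) →
      HasTy Ω Γ f₅ e₂ w f₆ T₁ →
      PotLe ((x, T₁) :: Ω) Γ ((f₃.ren (openWith [x])).subst w (.name x))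
        ((f₂.add f₆).subst w (.name x)) →
      HasTy ((x, T₁) :: Ω) Γ (f₁.add f₅) (.app e₁ e₂) y
        ((((f₂.add f₆).sub (f₃.ren (openWith [x]))).subst w (.name x)).add
          (f₄.ren (openWith [y, x])))
        (T₂.ren (openWith [y, x]))
  | letE {Ω Γ : Ctx R} {f₁ f₂ f₃ f₄ : Pot R} {e₁ e₂ : Tm R} {x y z : ℕ} {T₁ T₂ : Ty R} :
      Fresh x Ω Γ → x ∉ e₂.fv →
      HasTy Ω Γ f₁ e₁ z f₂ T₁ →
      HasTy Ω ((x, T₁) :: Γ) f₃ (e₂.ren (openWith [x])) y f₄ T₂ →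
      PotLe Ω ((x, T₁) :: Γ) f₃ (f₂.subst z (.name x)) →
      HasTy ((x, T₁) :: Ω) Γ f₁ (.letE e₁ e₂) y (((f₂.subst z (.name x)).sub f₃).add f₄) T₂
  | con {Ω Γ : Ctx R} {n : ℕ} {T : Fin n → Ty R} {m : Fin n → ℕ} (i : Fin n)
      {f₁ f₂ f₅ : Pot R} {f₃ f₄ : Fin (m i) → Pot R} {e₀ : Tm R} {e : Fin (m i) → Tm R}
      {x₀ y : ℕ} {x : Fin (m i) → ℕ} :
      Fresh y Ω Γ →
      HasTy Ω Γ f₁ e₀ x₀ f₂ (T i) →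
      (∀ j, HasTy Ω Γ (f₃ j) (e j) (x j) (f₄ j) (.ind n T m)) →
      (∀ j, x j = x₀ → ¬ Fresh x₀ Ω Γ) →
      (∀ j k, j ≠ k → x j = x k → ¬ Fresh (x j) Ω Γ) →
      PotWf ((y, .ind n T m) :: Ω) Γ f₅ →
      PotLe ((x₀, T i) :: List.ofFn (fun j => (x j, Ty.ind n T m)) ++ Ω) Γ
        (f₅.subst y (.con i (.name x₀) (m i) (fun j => .name (x j)))) (f₂.add (.sum f₄)) →
      HasTy Ω Γ (f₁.add (.sum f₃)) (.con i e₀ (m i) e) y f₅ (.ind n T m)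
  | des {Ω Γ : Ctx R} {n : ℕ} {T : Fin n → Ty R} {m : Fin n → ℕ}
      {f₁ f₂ f₃ : Pot R} {e₀ : Tm R} {e : Fin n → Tm R} {T₁ : Ty R}
      {x y : ℕ} {x₀ : Fin n → ℕ} {xr : (i : Fin n) → Fin (m i) → ℕ} :
      HasTy Ω Γ f₁ e₀ x f₂ (.ind n T m) →
      (∀ i, (x₀ i :: List.ofFn (xr i)).Nodup) →
      (∀ i, ∀ z ∈ x₀ i :: List.ofFn (xr i),
        Fresh z Ω Γ ∧ z ∉ (e i).fv ∧ z ∉ f₃.fv ∧ z ∉ T₁.fv) →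
      (∀ i, HasTy Ω ((x₀ i, T i) :: List.ofFn (fun j => (xr i j, Ty.ind n T m)) ++ Γ)
        (f₂.subst x (.con i (.name (x₀ i)) (m i) (fun j => .name (xr i j))))
        ((e i).ren (openWith (x₀ i :: List.ofFn (xr i)))) y f₃ T₁) →
      HasTy Ω Γ f₁ (.case e₀ n m e) y f₃ T₁
  /-- Potential functions are functions of the instantiation of their variables: an input potential
  may be replaced by one that takes the same values. -/
  | conv {Ω Γ : Ctx R} {f₁ f₁' f₂ : Pot R} {e : Tm R} {x : ℕ} {T : Ty R} :
      HasTy Ω Γ f₁ e x f₂ T → PotLe Ω Γ f₁ f₁' → PotLe Ω Γ f₁' f₁ →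
      HasTy Ω Γ f₁' e x f₂ T

/-- The list type `ind({nil(Unit,0), cons(T,1)})`. -/
def listTy {R : Type*} (T : Ty R) : Ty R := .ind 2 ![.unit, T] ![0, 1]

/-- The sum type `ind({left(T₁,0), right(T₂,0)})`. -/
def sumTy {R : Type*} (T₁ T₂ : Ty R) : Ty R := .ind 2 ![T₁, T₂] ![0, 0]

/-- The lazy tick: `e` is evaluated first, then `p` units are paid, `(λx. tick p x) e`. -/
def Tm.tickl {R : Type*} (p : R) (e : Tm R) : Tm R := .app (.lam (.tick p (.var (.bound 0)))) e

end AmorNA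

/-! ## Automatic amortized resource analysis -/

namespace AARA

open AmorNA (NN Var lift openWith dom)

/-- Resource-annotated types: `1`, `L^p(A)`, `A^p + B^r`, `A × B`, `A →^{p/q} B`. -/
inductive Ty (R : Type*) [CommRing R] [LinearOrder R] where
  | unit
  | list (p : NN R) (A : Ty R)
  | sum (A : Ty R) (p : NN R) (B : Ty R) (r : NN R)
  | prod (A B : Ty R)
  | arrow (A : Ty R) (p q : NN R) (B : Ty R)

/-- Expressions.  `letE` binds one variable in its second component; the branches of `caseSum` bind
one variable each; the `cons` branch of `caseList` binds the head (index `0`) and the tail (index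
`1`); `func e` is `fun f x = e`, with `x` index `0` and `f` index `1`; `share v e` is
`share v as x₁, x₂ in e`, with `x₁` index `0` and `x₂` index `1`. -/
inductive Exp (R : Type*) where
  | var (v : Var)
  | unit
  | letE (e₁ e₂ : Exp R)
  | left (e : Exp R)
  | right (e : Exp R)
  | caseSum (v : Var) (e₁ e₂ : Exp R)
  | nil
  | cons (v₁ v₂ : Var)
  | caseList (v : Var) (e₀ e₁ : Exp R)
  | app (v₁ v₂ : Var)
  | func (e : Exp R)
  | tick (t : R)
  | share (v : Var) (e : Exp R)

/-- Replacement of dangling indices by variables. -/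
def Exp.ren {R : Type*} : (ℕ → Var) → Exp R → Exp R
  | ξ, .var v => .var (v.ren ξ)
  | _, .unit => .unit
  | ξ, .letE e₁ e₂ => .letE (e₁.ren ξ) (e₂.ren (lift 1 ξ))
  | ξ, .left e => .left (e.ren ξ)
  | ξ, .right e => .right (e.ren ξ)
  | ξ, .caseSum v e₁ e₂ => .caseSum (v.ren ξ) (e₁.ren (lift 1 ξ)) (e₂.ren (lift 1 ξ))
  | _, .nil => .nil
  | ξ, .cons v₁ v₂ => .cons (v₁.ren ξ) (v₂.ren ξ)
  | ξ, .caseList v e₀ e₁ => .caseList (v.ren ξ) (e₀.ren ξ) (e₁.ren (lift 2 ξ))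
  | ξ, .app v₁ v₂ => .app (v₁.ren ξ) (v₂.ren ξ)
  | ξ, .func e => .func (e.ren (lift 2 ξ))
  | _, .tick t => .tick t
  | ξ, .share v e => .share (v.ren ξ) (e.ren (lift 2 ξ))

/-- Free names. -/
def Exp.fv {R : Type*} : Exp R → Finset ℕ
  | .var v => v.fv
  | .unit => ∅
  | .letE e₁ e₂ => e₁.fv ∪ e₂.fv
  | .left e => e.fv
  | .right e => e.fv
  | .caseSum v e₁ e₂ => v.fv ∪ e₁.fv ∪ e₂.fv
  | .nil => ∅
  | .cons v₁ v₂ => v₁.fv ∪ v₂.fv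
  | .caseList v e₀ e₁ => v.fv ∪ e₀.fv ∪ e₁.fv
  | .app v₁ v₂ => v₁.fv ∪ v₂.fv
  | .func e => e.fv
  | .tick _ => ∅
  | .share v e => v.fv ∪ e.fv

def Exp.size {R : Type*} : Exp R → ℕ
  | .letE e₁ e₂ => e₁.size + e₂.size + 1
  | .left e => e.size + 1
  | .right e => e.size + 1
  | .caseSum _ e₁ e₂ => e₁.size + e₂.size + 1
  | .caseList _ e₀ e₁ => e₀.size + e₁.size + 1
  | .func e => e.size + 1
  | .share _ e => e.size + 1
  | _ => 1

theorem Exp.size_ren {R : Type*} (e : Exp R) (ξ : ℕ → Var) : (e.ren ξ).size = e.size := by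
  induction e generalizing ξ <;> simp_all [Exp.ren, Exp.size]

/-- The replacement `x₁ ↦ v, x₂ ↦ v` under the two binders of `share`. -/
def dup (v : Var) : ℕ → Var
  | 0 => v
  | 1 => v
  | n + 2 => .bound n

/-- The resource constants of the cost model. -/
structure Costs (R : Type*) where
  cVar : R
  cUnit : R
  cLet₁ : R
  cLet₂ : R
  cLet₃ : R
  cLeft : R
  cRight : R
  cCaseLeft : R
  cCaseRight : R
  cNil : R
  cCons : R
  cCaseNil : R
  cCaseCons : R
  cApp : R
  cFun : R

abbrev Ctx (R : Type*) [CommRing R] [LinearOrder R] := List (ℕ × Ty R)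

/-- `A ⋎ (A₁, A₂)`: the potential of `A` is split between `A₁` and `A₂`. -/
inductive Share {R : Type*} [CommRing R] [LinearOrder R] : Ty R → Ty R → Ty R → Prop
  | unit : Share .unit .unit .unit
  | list {p p₁ p₂ : NN R} {A A₁ A₂ : Ty R} : (p : R) = p₁ + p₂ → Share A A₁ A₂ →
      Share (.list p A) (.list p₁ A₁) (.list p₂ A₂)
  | sum {p p₁ p₂ r r₁ r₂ : NN R} {A A₁ A₂ B B₁ B₂ : Ty R} :
      (p : R) = p₁ + p₂ → (r : R) = r₁ + r₂ → Share A A₁ A₂ → Share B B₁ B₂ →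
      Share (.sum A p B r) (.sum A₁ p₁ B₁ r₁) (.sum A₂ p₂ B₂ r₂)
  | prod {A A₁ A₂ B B₁ B₂ : Ty R} : Share A A₁ A₂ → Share B B₁ B₂ →
      Share (.prod A B) (.prod A₁ B₁) (.prod A₂ B₂)
  | arrow (A : Ty R) (p q : NN R) (B : Ty R) :
      Share (.arrow A p q B) (.arrow A p q B) (.arrow A p q B)

/-- `Judg K Γ q q' e A` is the judgement `Γ ⊢^q_{q'} e : A` for the cost model `K`.  Contexts are
unordered (rule `exch`) and declare each variable once. -/
inductive Judg {R : Type*} [CommRing R] [LinearOrder R] (K : Costs R) :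
    Ctx R → NN R → NN R → Exp R → Ty R → Prop
  | var {q q' : NN R} {A : Ty R} (x : ℕ) : (q : R) ≥ q' + K.cVar →
      Judg K [(x, A)] q q' (.var (.free x)) A
  | unit {q q' : NN R} : (q : R) ≥ q' + K.cUnit → Judg K [] q q' .unit .unit
  | letE {Γ₁ Γ₂ : Ctx R} {q q' p p' r r' : NN R} {e₁ e₂ : Exp R} {A B : Ty R} {x : ℕ} :
      (∀ y ∈ dom Γ₁, y ∉ dom Γ₂) → x ∉ dom Γ₁ → x ∉ dom Γ₂ → x ∉ e₂.fv →
      (q : R) ≥ p + K.cLet₁ → Judg K Γ₁ p p' e₁ A →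
      (p' : R) ≥ r + K.cLet₂ → Judg K ((x, A) :: Γ₂) r r' (e₂.ren (openWith [x])) B →
      (r' : R) ≥ q' + K.cLet₃ →
      Judg K (Γ₁ ++ Γ₂) q q' (.letE e₁ e₂) B
  | left {Γ : Ctx R} {q q' s s' p r : NN R} {e : Exp R} {A B : Ty R} :
      (q : R) ≥ s + K.cLeft → Judg K Γ s s' e A → (s' : R) ≥ q' + p →
      Judg K Γ q q' (.left e) (.sum A p B r)
  | right {Γ : Ctx R} {q q' s s' p r : NN R} {e : Exp R} {A B : Ty R} :
      (q : R) ≥ s + K.cRight → Judg K Γ s s' e B → (s' : R) ≥ q' + r →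
      Judg K Γ q q' (.right e) (.sum A p B r)
  | matchSum {Γ : Ctx R} {q q' s₁ s₂ p r : NN R} {e₁ e₂ : Exp R} {A B C : Ty R} {x x₁ x₂ : ℕ} :
      x ∉ dom Γ → x₁ ∉ dom Γ → x₂ ∉ dom Γ → x₁ ∉ e₁.fv → x₂ ∉ e₂.fv →
      (q : R) + p ≥ s₁ + K.cCaseLeft →
      Judg K ((x₁, A) :: Γ) s₁ q' (e₁.ren (openWith [x₁])) C →
      (q : R) + r ≥ s₂ + K.cCaseRight →
      Judg K ((x₂, B) :: Γ) s₂ q' (e₂.ren (openWith [x₂])) C →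
      Judg K ((x, .sum A p B r) :: Γ) q q' (.caseSum (.free x) e₁ e₂) C
  | nil {q q' p : NN R} {A : Ty R} : (q : R) ≥ q' + K.cNil → Judg K [] q q' .nil (.list p A)
  | cons {q q' p : NN R} {A : Ty R} {x₁ x₂ : ℕ} : x₁ ≠ x₂ → (q : R) ≥ q' + p + K.cCons →
      Judg K [(x₁, A), (x₂, .list p A)] q q' (.cons (.free x₁) (.free x₂)) (.list p A)
  | matchList {Γ : Ctx R} {q q' s₀ s₁ p : NN R} {e₀ e₁ : Exp R} {A B : Ty R} {x x₁ x₂ : ℕ} :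
      x ∉ dom Γ → x₁ ∉ dom Γ → x₂ ∉ dom Γ → x₁ ≠ x₂ → x₁ ∉ e₁.fv → x₂ ∉ e₁.fv →
      (q : R) ≥ s₀ + K.cCaseNil →
      Judg K Γ s₀ q' e₀ B →
      (q : R) + p ≥ s₁ + K.cCaseCons →
      Judg K ((x₁, A) :: (x₂, .list p A) :: Γ) s₁ q' (e₁.ren (openWith [x₁, x₂])) B →
      Judg K ((x, .list p A) :: Γ) q q' (.caseList (.free x) e₀ e₁) B
  | app {q q' p p' : NN R} {A B : Ty R} {x₁ x₂ : ℕ} : x₁ ≠ x₂ →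
      (q : R) ≥ p + K.cApp → (q : R) - q' ≥ p - p' + K.cApp →
      Judg K [(x₁, .arrow A p p' B), (x₂, A)] q q' (.app (.free x₁) (.free x₂)) B
  | func {Γ : Ctx R} {q q' p p' : NN R} {e : Exp R} {A B : Ty R} {f x : ℕ} :
      (∀ y C, (y, C) ∈ Γ → Share C C C) →
      f ∉ dom Γ → x ∉ dom Γ → x ≠ f → f ∉ e.fv → x ∉ e.fv →
      Judg K ((x, A) :: (f, .arrow A p p' B) :: Γ) p p' (e.ren (openWith [x, f])) B →
      (q : R) ≥ q' + K.cFun →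
      Judg K Γ q q' (.func e) (.arrow A p p' B)
  | tick {q q' : NN R} (t : R) : (q : R) ≥ q' + t → Judg K [] q q' (.tick t) .unit
  | relax {Γ : Ctx R} {q q' p p' : NN R} {e : Exp R} {A : Ty R} :
      Judg K Γ p p' e A → (q : R) ≥ p → (q : R) - q' ≥ p - p' → Judg K Γ q q' e A
  | weak {Γ : Ctx R} {q q' : NN R} {e : Exp R} {A B : Ty R} {x : ℕ} :
      x ∉ dom Γ → Judg K Γ q q' e B → Judg K ((x, A) :: Γ) q q' e B
  | share {Γ : Ctx R} {q q' : NN R} {e : Exp R} {A A₁ A₂ B : Ty R} {x x₁ x₂ : ℕ} :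
      Share A A₁ A₂ → x ∉ dom Γ → x₁ ∉ dom Γ → x₂ ∉ dom Γ → x₁ ≠ x₂ → x₁ ∉ e.fv → x₂ ∉ e.fv →
      Judg K ((x₁, A₁) :: (x₂, A₂) :: Γ) q q' (e.ren (openWith [x₁, x₂])) B →
      Judg K ((x, A) :: Γ) q q' (.share (.free x) e) B
  | exch {Γ Γ' : Ctx R} {q q' : NN R} {e : Exp R} {A : Ty R} :
      Γ.Perm Γ' → Judg K Γ q q' e A → Judg K Γ' q q' e A

/-! ## The translation -/

open AmorNA (Pot Tm)

/-- The potential function `Φ_a(A)` of a value `a` of type `A`. -/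
def phi {R : Type*} [CommRing R] [LinearOrder R] : Ty R → Tm R → Pot R
  | .unit, _ => .zero
  | .list p A, a => .prec a 2 ![0, 1]
      ![.zero, (phi A (.var (.bound 0))).add (.const p)]
      (fun _ _ => .val (.var (.bound 1)))
  | .sum A p B r, a => .prec a 2 ![0, 0]
      ![(phi A (.var (.bound 0))).add (.const p), (phi B (.var (.bound 0))).add (.const r)]
      (fun _ _ => .zero)
  | .prod A B, a => (phi A (.fst a)).add (phi B (.snd a))
  | .arrow _ _ _ _, _ => .zero

/-- The type `Type(A)` without potential annotations outside of arrows. -/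
def ty {R : Type*} [CommRing R] [LinearOrder R] : Ty R → AmorNA.Ty R
  | .unit => .unit
  | .list _ A => AmorNA.listTy (ty A)
  | .sum A _ B _ => AmorNA.sumTy (ty A) (ty B)
  | .prod A B => .prod (ty A) (ty B)
  | .arrow A p q B =>
      .arrow (ty A) (Pot.add (.const p) (phi A (.var (.bound 0))))
        (ty B) (Pot.add (.const q) (phi B (.var (.bound 0))))

/-- The potential `Φ(Γ)` of a context. -/
def ctxPot {R : Type*} [CommRing R] [LinearOrder R] : Ctx R → Pot R
  | [] => .zero
  | (x, A) :: Γ => (phi A (.name x)).add (ctxPot Γ)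

/-- The type context `Pure(Γ)`. -/
def pureCtx {R : Type*} [CommRing R] [LinearOrder R] (Γ : Ctx R) : AmorNA.Ctx R :=
  Γ.map (fun b => (b.1, ty b.2))

/-- The translation of terms. -/
def h {R : Type*} (K : Costs R) : Exp R → Tm R
  | .var v => .tick K.cVar (.var v)
  | .unit => .tick K.cUnit .unit
  | .letE e₁ e₂ =>
      .tickl K.cLet₃ (.letE (.tick K.cLet₁ (h K e₁)) (.tick K.cLet₂ (h K e₂)))
  | .left e => .tick K.cLeft (.con 0 (h K e) 0 Fin.elim0)
  | .right e => .tick K.cRight (.con 1 (h K e) 0 Fin.elim0)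
  | .caseSum v e₁ e₂ => .case (.var v) 2 ![0, 0]
      ![.tick K.cCaseLeft (h K e₁), .tick K.cCaseRight (h K e₂)]
  | .nil => .tick K.cNil (.con 0 .unit 0 Fin.elim0)
  | .cons v₁ v₂ => .tick K.cCons (.con 1 (.var v₁) 1 (fun _ => .var v₂))
  | .caseList v e₀ e₁ => .case (.var v) 2 ![0, 1]
      ![.tick K.cCaseNil ((h K e₀).ren (fun n => .bound (n + 1))), .tick K.cCaseCons (h K e₁)]
  | .app v₁ v₂ => .tick K.cApp (.app (.var v₁) (.var v₂))
  | .func e => .tick K.cFun (.fix (.lam (h K e)))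
  | .tick t => .tick t .unit
  | .share v e => h K (e.ren (dup v))
termination_by e => e.size
decreasing_by all_goals (simp only [Exp.size, Exp.size_ren]; omega)

end AARA

namespace AmorNA

/-! ## Replacement of indices -/

/-! The theorem is proved by induction on the AARA derivation, with the exact output `q' + Φ_y(A)`
for every fresh result binder `y`; no weaker output is ever needed, so the inequality for `Φ'` is
reflexivity.

The induction statement (`embedding`) is stronger in two ways. The type context is any `Δ` with
closed types containing the translated context: types are not linear in the target, only potential
is, so weakening, exchange and the splitting of contexts concern potential alone. The free names are
also renamed by an arbitrary, possibly non-injective `θ`. This absorbs the choice of bound names and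
handles sharing: both copies go to one name, which keeps one type (`ty_share`), while its potential
is the sum of the two shares (`phiVal_share`).

Two facts turn the derivations into linear arithmetic. By `eval_phi`, `Φ_a(A)` depends only on the
value of `a`, through a function `phiVal A` that is nonnegative on all values, typed or not. By
`HasTy.conseq`, TRelax, TDrop and TConv together say that extra input may be carried to the output
and part of the output discarded; `HasTy.tick` adds a cost of either sign. Each AARA construct then
needs one target rule (`hasTy_app`, `hasTy_letE`, `hasTy_con`, `hasTy_case`) and a check of
constants.

Recursive functions are typable with no input potential because every type `C` of their context
satisfies `C ⋎ (C, C)`, so its potential `φ` satisfies `φ = φ + φ` and vanishes. The last cost of a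
`let` is paid by a lazy tick because its premise bounds only what is left after evaluation. -/

theorem Var.ren_ren (v : Var) (ξ η : ℕ → Var) :
    (v.ren ξ).ren η = v.ren (fun n => (ξ n).ren η) := by
  cases v <;> rfl

theorem lift_ren (k : ℕ) (ξ η : ℕ → Var) (n : ℕ) :
    (lift k ξ n).ren (lift k η) = lift k (fun n => (ξ n).ren η) n := by
  unfold lift
  split_ifs with hn
  · simp [Var.ren, hn]
  · cases hξ : ξ (n - k) <;> simp [Var.ren, Var.shift, hξ]

theorem lift_lift (k l : ℕ) (ξ : ℕ → Var) : lift k (lift l ξ) = lift (l + k) ξ := by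
  funext n
  unfold lift
  split_ifs
  all_goals try omega
  · rfl
  · simp only [Var.shift]; congr 1; omega
  · rw [show n - k - l = n - (l + k) by omega]
    cases ξ (n - (l + k)) <;> simp [Var.shift, add_assoc]

theorem lift_bound (k : ℕ) : lift k Var.bound = Var.bound := by
  funext n
  unfold lift
  split_ifs with hn
  · rfl
  · simp only [Var.shift]; congr 1; omega

theorem Tm.ren_ren {R : Type*} (e : Tm R) (ξ η : ℕ → Var) :
    (e.ren ξ).ren η = e.ren (fun n => (ξ n).ren η) := by
  induction e generalizing ξ η <;> simp_all [Tm.ren, Var.ren_ren, lift_ren]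

theorem Var.ren_bound (v : Var) : v.ren Var.bound = v := by
  cases v <;> rfl

theorem Tm.ren_bound {R : Type*} (e : Tm R) : e.ren Var.bound = e := by
  induction e <;> simp_all [Tm.ren, Var.ren_bound, lift_bound]

/-- Opening two binders one after the other. -/
theorem Tm.open_open {R : Type*} (e : Tm R) (x f : ℕ) :
    (e.ren (lift 1 (openWith [f]))).ren (openWith [x]) = e.ren (openWith [x, f]) := by
  rw [Tm.ren_ren]
  congr 1
  funext n
  rcases n with _ | _ | n <;> simp [lift, openWith, Var.ren, Var.shift]

/-- Opening a binder that is not used. -/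
theorem Tm.open_weaken {R : Type*} (e : Tm R) (x : ℕ) :
    (e.ren (fun n => .bound (n + 1))).ren (openWith [x]) = e := by
  rw [Tm.ren_ren]
  exact e.ren_bound

/-- Renaming of the free names. -/
def Var.nren (θ : ℕ → ℕ) : Var → Var
  | .bound n => .bound n
  | .free x => .free (θ x)

theorem Var.ren_nren (v : Var) {θ θ' : ℕ → ℕ} (ξ : ℕ → Var) (hθ : ∀ x ∈ v.fv, θ x = θ' x) :
    (v.ren ξ).nren θ = (v.nren θ').ren (fun n => (ξ n).nren θ) := by
  cases v <;> simp_all [Var.ren, Var.nren, Var.fv]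

theorem lift_nren (k : ℕ) (ξ : ℕ → Var) (θ : ℕ → ℕ) :
    (fun n => (lift k ξ n).nren θ) = lift k (fun n => (ξ n).nren θ) := by
  funext n
  unfold lift
  split_ifs with hn
  · rfl
  · cases hξ : ξ (n - k) <;> simp [Var.nren, Var.shift, hξ]

/-! ## Potential functions -/

/-- Taking the result binder of a premise equal to the bound variable of TApp or TLet makes their
substitutions `w ↦ x` vacuous. -/
theorem Tm.subst_self {R : Type*} (e : Tm R) (x : ℕ) : e.subst x (.name x) = e := by
  induction e with
  | var v => cases v <;> simp +contextual [Tm.subst]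
  | _ => simp_all [Tm.subst]

theorem Pot.subst_self {R : Type*} (f : Pot R) (x : ℕ) : f.subst x (.name x) = f := by
  induction f <;> simp_all [Pot.subst, Tm.subst_self]

theorem Tm.subst_of_notMem {R : Type*} (e u : Tm R) {x : ℕ} (hx : x ∉ e.fv) :
    e.subst x u = e := by
  induction e with
  | var v => cases v <;> simp_all [Tm.subst, Tm.fv, Var.fv, eq_comm]
  | _ => simp_all [Tm.subst, Tm.fv]

theorem Pot.subst_of_notMem {R : Type*} (f : Pot R) (u : Tm R) {x : ℕ} (hx : x ∉ f.fv) :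
    f.subst x u = f := by
  induction f <;> simp_all [Pot.subst, Pot.fv, Tm.subst_of_notMem]

theorem mem_dom {T : Type*} {Γ : List (ℕ × T)} {x : ℕ} {t : T} (h : (x, t) ∈ Γ) : x ∈ dom Γ :=
  List.mem_map.2 ⟨_, h, rfl⟩

theorem dom_mono {T : Type*} {Γ Γ' : List (ℕ × T)} (h : Γ ⊆ Γ') : dom Γ ⊆ dom Γ' :=
  List.map_subset _ h

theorem ArgTy.mono {R : Type*} {Δ Δ' : Ctx R} (hΔ : Δ ⊆ Δ') {a : Tm R} {T : Ty R}
    (h : ArgTy Δ a T) : ArgTy Δ' a T := by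
  induction h with
  | var hx => exact .var (hΔ hx)
  | unit => exact .unit
  | int i => exact .int i
  | op o _ _ h₁ h₂ => exact .op o h₁ h₂
  | pair _ _ h₁ h₂ => exact .pair h₁ h₂
  | fst _ h => exact .fst h
  | snd _ h => exact .snd h
  | con i _ _ h₀ h => exact .con i h₀ h
  | lam T₁ f₁ T₂ f₂ h => exact .lam T₁ f₁ T₂ f₂ (fun x hx => dom_mono hΔ (h x hx))
  | tlam T₁ T₂ h => exact .tlam T₁ T₂ (fun x hx => dom_mono hΔ (h x hx))

theorem Ctx.without_mono {R : Type*} {Δ Δ' : Ctx R} (hΔ : Δ ⊆ Δ') (s : Finset ℕ) :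
    Δ.without s ⊆ Δ'.without s := by
  intro b hb
  simp only [Ctx.without, List.mem_filter] at hb ⊢
  exact ⟨hΔ hb.1, hb.2⟩

/-- The branches of a recursion are checked for all names outside the context, and a name outside
the larger context is outside the smaller one; so no renaming of potential functions is needed. -/
theorem PotOk.mono {R : Type*} {Δ Δ' : Ctx R} (hΔ : Δ ⊆ Δ') {f : Pot R} (h : PotOk Δ f) :
    PotOk Δ' f := by
  induction h generalizing Δ' with
  | const _ c => exact .const _ c
  | val h => exact .val (h.mono hΔ)
  | add _ _ h₁ h₂ => exact .add (h₁ hΔ) (h₂ hΔ)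
  | sub _ _ h₁ h₂ => exact .sub (h₁ hΔ) (h₂ hΔ)
  | mul _ _ hd h₁ h₂ => exact .mul (h₁ hΔ) (h₂ hΔ) hd
  | prec ha _ _ hb hs =>
    refine .prec (ha.mono hΔ) (fun i x hx hx' => hb i x (fun h => hx (dom_mono hΔ h)) hx' ?_)
      (fun i j x r hxr hx hr hx' hr' => hs i j x r hxr (fun h => hx (dom_mono hΔ h))
        (fun h => hr (dom_mono hΔ h)) hx' hr' ?_)
    · exact List.cons_subset_cons _ (Ctx.without_mono hΔ _)
    · exact List.cons_subset_cons _ (List.cons_subset_cons _ (Ctx.without_mono hΔ _))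

@[simp] theorem Pot.eval_const {R : Type*} [CommRing R] (ρ : ℕ → Val R) (σ : List (Val R)) (c : R) :
    (Pot.const c).eval ρ σ = c := by simp [Pot.eval]

@[simp] theorem Pot.eval_zero {R : Type*} [CommRing R] (ρ : ℕ → Val R) (σ : List (Val R)) :
    (Pot.zero : Pot R).eval ρ σ = 0 := by simp [Pot.zero]

@[simp] theorem Pot.eval_add {R : Type*} [CommRing R] (ρ : ℕ → Val R) (σ : List (Val R))
    (f g : Pot R) : (f.add g).eval ρ σ = f.eval ρ σ + g.eval ρ σ := by
  simp [Pot.add, Pot.eval, Op.eval]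

@[simp] theorem Pot.eval_sub {R : Type*} [CommRing R] (ρ : ℕ → Val R) (σ : List (Val R))
    (f g : Pot R) : (f.sub g).eval ρ σ = f.eval ρ σ - g.eval ρ σ := by
  simp [Pot.sub, Pot.eval, Op.eval]

theorem PotOk.zero {R : Type*} [CommRing R] {Δ : Ctx R} : PotOk Δ Pot.zero := .const _ _

theorem Pot.eval_sum {R : Type*} [CommRing R] {m : ℕ} (f : Fin m → Pot R) (ρ : ℕ → Val R) (σ : List (Val R)) :
    (Pot.sum f).eval ρ σ = ∑ j, (f j).eval ρ σ := by
  rw [← List.sum_ofFn, Pot.sum]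
  induction m with
  | zero => simp
  | succ m ih => simp [List.ofFn_succ, ih]

theorem PotOk.sum {R : Type*} [CommRing R] {Δ : Ctx R} {m : ℕ} {f : Fin m → Pot R} (h : ∀ j, PotOk Δ (f j)) :
    PotOk Δ (.sum f) := by
  rw [Pot.sum]
  induction m with
  | zero => exact .zero
  | succ m ih => rw [List.ofFn_succ]; exact .add (h 0) (ih fun j => h j.succ)

/-! ## Derived typing rules -/

section Rules

variable {R : Type*} [CommRing R] [LinearOrder R] [IsStrictOrderedRing R] {Ω Γ : Ctx R}
  {f₁ f₂ F G : Pot R} {e : Tm R} {y : ℕ} {T : Ty R}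

/-- The rule of consequence: the input may grow, and its excess may be moved to the output. -/
theorem HasTy.conseq (h : HasTy Ω Γ f₁ e y f₂ T)
    (hy : ∀ x T₁ T₂, (x, T₁) ∈ (y, T) :: Ω → (x, T₂) ∈ Γ → T₁ = T₂)
    (w₁ : PotOk (Ω ++ Γ) f₁) (wF : PotOk (Ω ++ Γ) F)
    (w₂ : PotOk ((y, T) :: Ω ++ Γ) f₂) (wG : PotOk ((y, T) :: Ω ++ Γ) G)
    (h₁ : ∀ ρ, f₁.eval ρ [] ≤ F.eval ρ [])
    (h₂ : ∀ ρ, G.eval ρ [] + f₁.eval ρ [] ≤ f₂.eval ρ [] + F.eval ρ []) :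
    HasTy Ω Γ F e y G T := by
  have hΩ : ∀ x T₁ T₂, (x, T₁) ∈ Ω → (x, T₂) ∈ Γ → T₁ = T₂ :=
    fun x T₁ T₂ hx => hy x T₁ T₂ (List.mem_cons_of_mem _ hx)
  have hsub : Ω ++ Γ ⊆ (y, T) :: Ω ++ Γ := List.subset_cons_self _ _
  -- The frame is the excess `F - f₁`, nonnegative by `h₁`; `h₂` says that `G` is at most `f₂ + (F -
  -- f₁)`. The input `f₁ + (F - f₁)` equals `F` only in value, whence the final conversion.
  have hr := h.relax (f₃ := F.sub f₁) ⟨⟨hΩ, .zero⟩, ⟨hΩ, .sub wF w₁⟩, fun ρ _ => by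
    have := h₁ ρ; simp only [Pot.eval_zero, Pot.eval_sub]; linarith⟩
  have wr : PotWf Ω Γ (f₁.add (F.sub f₁)) := ⟨hΩ, .add w₁ (.sub wF w₁)⟩
  refine (hr.drop (f₃ := G) ⟨⟨hy, wG⟩, ⟨hy, .add w₂ (.sub (wF.mono hsub) (w₁.mono hsub))⟩,
    fun ρ _ => ?_⟩).conv ⟨wr, ⟨hΩ, wF⟩, fun ρ _ => ?_⟩ ⟨⟨hΩ, wF⟩, wr, fun ρ _ => ?_⟩
  · have := h₂ ρ; simp only [Pot.eval_add, Pot.eval_sub]; linarith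
  · simp
  · simp

/-- Ticks of either sign. -/
theorem HasTy.tick {c : R} (h : HasTy Ω Γ f₁ e y f₂ T)
    (hy : ∀ x T₁ T₂, (x, T₁) ∈ (y, T) :: Ω → (x, T₂) ∈ Γ → T₁ = T₂)
    (w₁ : PotOk (Ω ++ Γ) f₁) (wF : PotOk (Ω ++ Γ) F)
    (w₂ : PotOk ((y, T) :: Ω ++ Γ) f₂) (wG : PotOk ((y, T) :: Ω ++ Γ) G)
    (h₁ : ∀ ρ, f₁.eval ρ [] + c ≤ F.eval ρ [])
    (h₂ : ∀ ρ, G.eval ρ [] + f₁.eval ρ [] + c ≤ f₂.eval ρ [] + F.eval ρ []) :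
    HasTy Ω Γ F (.tick c e) y G T := by
  have hF : PotOk (Ω ++ Γ) (F.sub (.const c)) := .sub wF (.const _ _)
  have hm : HasTy Ω Γ (F.sub (.const c)) e y G T :=
    h.conseq hy w₁ hF w₂ wG
      (fun ρ => by have := h₁ ρ; simp only [Pot.eval_sub, Pot.eval_const]; linarith)
      (fun ρ => by have := h₂ ρ; simp only [Pot.eval_sub, Pot.eval_const]; linarith)
  have hΩ : ∀ x T₁ T₂, (x, T₁) ∈ Ω → (x, T₂) ∈ Γ → T₁ = T₂ :=
    fun x T₁ T₂ hx => hy x T₁ T₂ (List.mem_cons_of_mem _ hx)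
  rcases le_or_gt 0 c with hc | hc
  -- TTickp returns the input `(F - c) + c`, which must be converted to `F`; TTickn has `F - c` in
  -- its premise and returns `F` itself.
  · have wr : PotWf Ω Γ ((F.sub (.const c)).add (.const c)) := ⟨hΩ, .add hF (.const _ _)⟩
    exact (hm.tickp hc).conv ⟨wr, ⟨hΩ, wF⟩, fun ρ _ => by simp⟩ ⟨⟨hΩ, wF⟩, wr, fun ρ _ => by simp⟩
  · exact hm.tickn hc

end Rules

/-- Binders of a result that are declared nowhere are consistent with the context. -/
theorem consistent_of_notMem {R : Type*} {Γ Ω : Ctx R} (h : ∀ y ∈ dom Ω, y ∉ dom Γ) :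
    ∀ x T₁ T₂, (x, T₁) ∈ Ω → (x, T₂) ∈ Γ → T₁ = T₂ :=
  fun x _ _ h₁ h₂ => absurd (mem_dom h₂) (h x (mem_dom h₁))

theorem consistent_single {R : Type*} {Δ : Ctx R} {y : ℕ} {T : Ty R} (hy : y ∉ dom Δ) :
    ∀ x T₁ T₂, (x, T₁) ∈ [(y, T)] → (x, T₂) ∈ Δ → T₁ = T₂ :=
  consistent_of_notMem (by simpa [dom] using hy)

theorem not_occurs {R : Type*} {Δ : Ctx R} (hc : ∀ b ∈ Δ, b.2.fv = ∅) (x : ℕ) : ¬ Ctx.Occurs x Δ := by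
  rintro ⟨y, T, hT, hx⟩
  simp [hc _ hT] at hx

/-- Constructors and branches need as many distinct fresh names as their arity; `N, N + 1, …`
supplies them uniformly. -/
theorem exists_bound (s : Finset ℕ) : ∃ N, ∀ k, N + k ∉ s :=
  ⟨s.sup id + 1, fun k hk => by
    have : s.sup id + 1 + k ≤ s.sup id := Finset.le_sup (f := id) hk
    omega⟩

end AmorNA

namespace AARA

open AmorNA

/-! ## Renaming of expressions -/

/-- Renaming of the free names. -/
def Exp.nren {R : Type*} (θ : ℕ → ℕ) : Exp R → Exp R
  | .var v => .var (v.nren θ)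
  | .unit => .unit
  | .letE e₁ e₂ => .letE (e₁.nren θ) (e₂.nren θ)
  | .left e => .left (e.nren θ)
  | .right e => .right (e.nren θ)
  | .caseSum v e₁ e₂ => .caseSum (v.nren θ) (e₁.nren θ) (e₂.nren θ)
  | .nil => .nil
  | .cons v₁ v₂ => .cons (v₁.nren θ) (v₂.nren θ)
  | .caseList v e₀ e₁ => .caseList (v.nren θ) (e₀.nren θ) (e₁.nren θ)
  | .app v₁ v₂ => .app (v₁.nren θ) (v₂.nren θ)
  | .func e => .func (e.nren θ)
  | .tick t => .tick t
  | .share v e => .share (v.nren θ) (e.nren θ)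

theorem Exp.ren_ren {R : Type*} (e : Exp R) (ξ η : ℕ → Var) :
    (e.ren ξ).ren η = e.ren (fun n => (ξ n).ren η) := by
  induction e generalizing ξ η <;> simp_all [Exp.ren, Var.ren_ren, lift_ren]

/-- Two renamings are allowed so that the name used to open a binder can be redirected: `θ` may
differ from `θ'` there, since that name is not free in `e`. -/
theorem Exp.ren_nren {R : Type*} (e : Exp R) {θ θ' : ℕ → ℕ} (ξ : ℕ → Var)
    (hθ : ∀ x ∈ e.fv, θ x = θ' x) :
    (e.ren ξ).nren θ = (e.nren θ').ren (fun n => (ξ n).nren θ) := by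
  induction e generalizing ξ <;>
    simp_all [Exp.ren, Exp.nren, Exp.fv, Var.ren_nren _ _, lift_nren]

theorem Exp.nren_id {R : Type*} (e : Exp R) : e.nren id = e := by
  have hv : ∀ v : Var, v.nren id = v := fun v => by cases v <;> rfl
  induction e <;> simp_all [Exp.nren]

theorem dup_ren (v : Var) (ξ : ℕ → Var) (n : ℕ) :
    (lift 2 ξ n).ren (dup (v.ren ξ)) = (dup v n).ren ξ := by
  rcases n with _ | _ | n
  · simp [lift, dup, Var.ren]
  · simp [lift, dup, Var.ren]
  · have hl : lift 2 ξ (n + 2) = (ξ n).shift 2 := by simp [lift]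
    rw [hl]
    cases hξ : ξ n <;> simp [Var.shift, dup, Var.ren, hξ]

/-- AARA rules open a binder before translation, target rules after it. The induction is on size
because `share` translates `e.ren (dup v)`, which is not a subterm but has the size of `e`. -/
theorem h_ren {R : Type*} (K : Costs R) (e : Exp R) (ξ : ℕ → Var) :
    h K (e.ren ξ) = (h K e).ren ξ := by
  induction hn : e.size using Nat.strong_induction_on generalizing e ξ with
  | _ n ih =>
  subst hn
  cases e with
  | share v e =>
    simp only [Exp.ren, h]
    rw [← ih _ (by simp [Exp.size, Exp.size_ren]) _ _ rfl, Exp.ren_ren, Exp.ren_ren]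
    simp only [dup_ren]
  | letE e₁ e₂ =>
    simp [Exp.ren, h, Tm.ren, Tm.tickl, lift, Var.ren,
      ih e₁.size (by simp only [Exp.size]; omega) _ _ rfl, ih e₂.size (by simp only [Exp.size]; omega) _ _ rfl]
  | caseSum v e₁ e₂ =>
    simp only [Exp.ren, h, Tm.ren,
      ih e₁.size (by simp only [Exp.size]; omega) _ _ rfl, ih e₂.size (by simp only [Exp.size]; omega) _ _ rfl]
    congr 1
    funext i
    fin_cases i <;> rfl
  | caseList v e₀ e₁ =>
    simp only [Exp.ren, h, Tm.ren,
      ih e₀.size (by simp only [Exp.size]; omega) _ _ rfl, ih e₁.size (by simp only [Exp.size]; omega) _ _ rfl]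
    congr 1
    funext i
    fin_cases i
    -- The target `nil` branch binds a `Unit` content that AARA does not have; the shift that skips
    -- this index commutes with the lifted replacement.
    · simp only [Tm.ren_ren, Fin.zero_eta, Matrix.cons_val_zero, Tm.ren]
      congr 2
    · rfl
  | func e =>
    simp only [Exp.ren, h, Tm.ren, ih e.size (by simp [Exp.size]) _ _ rfl]
    -- The double binder of `func` becomes the nested binders of `fix` and `lam`.
    rw [lift_lift]
  | left e =>
    simp only [Exp.ren, h, Tm.ren, ih e.size (by simp [Exp.size]) _ _ rfl]
    congr 2; funext j; exact j.elim0
  | right e =>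
    simp only [Exp.ren, h, Tm.ren, ih e.size (by simp [Exp.size]) _ _ rfl]
    congr 2; funext j; exact j.elim0
  | nil => simp only [Exp.ren, h, Tm.ren]; congr 2; funext j; exact j.elim0
  | _ => simp [Exp.ren, h, Tm.ren]

/-! ## The potential of a value -/

section Phi

variable {R : Type*} [CommRing R] [LinearOrder R]

theorem phi_ren (A : Ty R) (a : Tm R) (ξ : ℕ → Var) : (phi A a).ren ξ = phi A (a.ren ξ) := by
  induction A generalizing a ξ with
  | unit => rfl
  | list p A ih =>
    simp only [phi, Pot.ren]
    congr 1; funext i; fin_cases i <;>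
      simp [Pot.ren, Pot.zero, Pot.add, ih, Tm.ren, Var.ren, lift]
  | sum A p B r ihA ihB =>
    simp only [phi, Pot.ren]
    congr 1; funext i; fin_cases i <;>
      simp [Pot.ren, Pot.add, ihA, ihB, Tm.ren, Var.ren, lift]
  | prod A B ihA ihB => simp [phi, Pot.add, Pot.ren, ihA, ihB, Tm.ren]
  | arrow => rfl

theorem phi_subst (A : Ty R) (a : Tm R) (x : ℕ) (u : Tm R) :
    (phi A a).subst x u = phi A (a.subst x u) := by
  induction A generalizing a with
  | unit => rfl
  | list p A ih =>
    simp only [phi, Pot.subst]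
    congr 1; funext i; fin_cases i <;> simp [Pot.subst, Pot.zero, Pot.add, ih, Tm.subst]
  | sum A p B r ihA ihB =>
    simp only [phi, Pot.subst]
    congr 1; funext i; fin_cases i <;> simp [Pot.subst, Pot.add, ihA, ihB, Tm.subst]
  | prod A B ihA ihB => simp [phi, Pot.add, Pot.subst, ihA, ihB, Tm.subst]
  | arrow => rfl

theorem phi_fv (A : Ty R) (a : Tm R) : (phi A a).fv ⊆ a.fv := by
  induction A generalizing a with
  | unit => exact Finset.empty_subset _
  | list p A ih =>
    have := ih (.var (.bound 0))
    simp_all [phi, Pot.fv, Pot.zero, Pot.add, Tm.fv, Var.fv, Finset.subset_iff]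
  | sum A p B r ihA ihB =>
    have hA := ihA (.var (.bound 0))
    have hB := ihB (.var (.bound 0))
    simp_all [phi, Pot.fv, Pot.zero, Pot.add, Tm.fv, Var.fv, Finset.subset_iff]
  | prod A B ihA ihB => exact Finset.union_subset (ihA (.fst a)) (ihB (.snd a))
  | arrow => exact Finset.empty_subset _

theorem phi_bound_fv (A : Ty R) (n : ℕ) : (phi A (.var (.bound n))).fv = ∅ :=
  Finset.subset_empty.1 (phi_fv A _)

theorem ty_ren (A : Ty R) (ξ : ℕ → Var) : (ty A).ren ξ = ty A := by
  induction A generalizing ξ with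
  | unit => rfl
  | list p A ih =>
    simp only [ty, listTy, AmorNA.Ty.ren]
    congr 1; funext i; fin_cases i <;> simp [AmorNA.Ty.ren, ih]
  | sum A p B r ihA ihB =>
    simp only [ty, sumTy, AmorNA.Ty.ren]
    congr 1; funext i; fin_cases i <;> simp [ihA, ihB]
  | prod A B ihA ihB => simp [ty, AmorNA.Ty.ren, ihA, ihB]
  | arrow A p q B ihA ihB =>
    simp [ty, AmorNA.Ty.ren, ihA, ihB, Pot.add, Pot.ren, phi_ren, Tm.ren, Var.ren, lift]

theorem ty_subst (A : Ty R) (x : ℕ) (u : Tm R) : (ty A).subst x u = ty A := by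
  induction A with
  | unit => rfl
  | list p A ih =>
    simp only [ty, listTy, AmorNA.Ty.subst]
    congr 1; funext i; fin_cases i <;> simp [AmorNA.Ty.subst, ih]
  | sum A p B r ihA ihB =>
    simp only [ty, sumTy, AmorNA.Ty.subst]
    congr 1; funext i; fin_cases i <;> simp [ihA, ihB]
  | prod A B ihA ihB => simp [ty, AmorNA.Ty.subst, ihA, ihB]
  | arrow A p q B ihA ihB =>
    simp [ty, AmorNA.Ty.subst, ihA, ihB, Pot.add, Pot.subst, phi_subst, Tm.subst]

/-- The potentials in arrows mention only the variables bound by the arrow. This settles every side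
condition about names free in types, in particular those of TErase. -/
theorem ty_fv (A : Ty R) : (ty A).fv = ∅ := by
  induction A with
  | unit => rfl
  | list p A ih => simp_all [ty, listTy, AmorNA.Ty.fv, Finset.eq_empty_iff_forall_notMem]
  | sum A p B r ihA ihB =>
    simp_all [ty, sumTy, AmorNA.Ty.fv, Finset.eq_empty_iff_forall_notMem]
  | prod A B ihA ihB => simp [ty, AmorNA.Ty.fv, ihA, ihB]
  | arrow A p q B ihA ihB =>
    simp [ty, AmorNA.Ty.fv, ihA, ihB, Pot.add, Pot.fv, phi_bound_fv]

/-- The branches of `Φ` mention only their own bound variables, so the removal of the scrutinee's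
variables from the context costs nothing. -/
theorem potOk_phi {Δ : AmorNA.Ctx R} (A : Ty R) {a : Tm R} (ha : ArgTy Δ a (ty A)) :
    PotOk Δ (phi A a) := by
  induction A generalizing Δ a with
  | unit => exact .zero
  | list p A ih =>
    refine .prec ha (fun i x _ _ => ?_) (fun i j x r _ _ _ _ _ => ?_)
    · fin_cases i
      · exact .zero
      · simp only [Pot.add, Pot.ren, phi_ren, Tm.ren, Var.ren, Matrix.cons_val_one,
          Matrix.cons_val_zero, Fin.mk_one]
        exact .add (ih (.var (by simp))) (.const _ _)
    · exact .val (.var (by simp))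
  | sum A p B r ihA ihB =>
    refine .prec ha (fun i x _ _ => ?_) (fun i j x r _ _ _ _ _ => .zero)
    fin_cases i
    · simp only [Pot.add, Pot.ren, phi_ren, Tm.ren, Var.ren, Matrix.cons_val_zero, Fin.zero_eta]
      exact .add (ihA (.var (by simp))) (.const _ _)
    · simp only [Pot.add, Pot.ren, phi_ren, Tm.ren, Var.ren, Matrix.cons_val_one,
          Matrix.cons_val_zero, Fin.mk_one]
      exact .add (ihB (.var (by simp))) (.const _ _)
  | prod A B ihA ihB => exact .add (ihA (.fst ha)) (ihB (.snd ha))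
  | arrow => exact .zero

theorem potOk_phi_name {Δ : AmorNA.Ctx R} {A : Ty R} {x : ℕ} (h : (x, ty A) ∈ Δ) :
    PotOk Δ (phi A (.name x)) :=
  potOk_phi A (.var h)

/-- The potential that `A` assigns to a value. -/
def phiVal : Ty R → Val R → R
  | .unit, _ => 0
  | .list p A, v => Val.fold (fun i w => if i = 1 then phiVal A w + p else 0)
      (fun i j _ r => if i = 1 ∧ j = 0 then r else 0) v
  | .sum A p B r, v => Val.fold
      (fun i w => if i = 0 then phiVal A w + p else if i = 1 then phiVal B w + r else 0)
      (fun _ _ _ _ => 0) v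
  | .prod A B, v => phiVal A v.proj₁ + phiVal B v.proj₂
  | .arrow _ _ _ _, _ => 0

/-- Through `phiVal`, every inequality between potentials becomes arithmetic over values. -/
theorem eval_phi (A : Ty R) (a : Tm R) (ρ : ℕ → Val R) (σ : List (Val R)) :
    (phi A a).eval ρ σ = phiVal A (a.eval ρ σ) := by
  induction A generalizing a σ with
  | unit => simp [phi, phiVal]
  | list p A ih =>
    simp only [phi, phiVal, Pot.eval]
    congr 1
    · funext i v
      rcases i with _ | _ | i <;> simp [ih, Tm.eval]
    · funext i j v r
      rcases i with _ | _ | i <;> simp [Tm.eval, Val.toInt]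
  | sum A p B r ihA ihB =>
    simp only [phi, phiVal, Pot.eval]
    congr 1
    · funext i v
      rcases i with _ | _ | i <;> simp [ihA, ihB, Tm.eval]
    · funext i j v r
      rcases i with _ | _ | i <;> simp
  | prod A B ihA ihB => simp [phi, phiVal, ihA, ihB, Tm.eval]
  | arrow => simp [phi, phiVal]

/-- Potential is linear in the annotations. The identity holds at ill-typed values too, since all
defaults are `0`. -/
theorem phiVal_share {A A₁ A₂ : Ty R} (hS : Share A A₁ A₂) (v : Val R) :
    phiVal A v = phiVal A₁ v + phiVal A₂ v := by
  induction hS generalizing v with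
  | unit => simp [phiVal]
  | list hp _ ih =>
    simp only [phiVal, ih, hp]
    -- For lists the split at the head comes from the element type, and the split of the tail needs
    -- a second induction, on the value.
    induction v with
    | con i v₀ m vs _ ihs =>
      rcases Decidable.em (i = 1) with rfl | hi
      · simp only [Val.fold, ihs, true_and, if_true]
        have hite (P : Prop) [Decidable P] (a b : R) :
            (if P then a + b else 0) = (if P then a else 0) + if P then b else 0 := ite_add_zero
        rw [Finset.sum_congr rfl fun j _ => hite _ _ _, Finset.sum_add_distrib]
        ring
      · simp [Val.fold, hi]
    | _ => simp [Val.fold]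
  | sum hp hr _ _ ihA ihB =>
    cases v <;> simp only [phiVal, Val.fold, ihA, ihB, hp, hr]
    case con => split_ifs <;> simp <;> ring
    all_goals simp
  | prod _ _ ihA ihB => simp only [phiVal, ihA, ihB]; ring
  | arrow => simp [phiVal]

theorem phiVal_cons (p : NN R) (A : Ty R) (v : Val R) (vs : Fin 1 → Val R) :
    phiVal (.list p A) (.con 1 v 1 vs) = phiVal A v + p + phiVal (.list p A) (vs 0) := by
  simp [phiVal, Val.fold]

/-- Sharing alters only annotations outside arrows, exactly those that `ty` forgets. -/
theorem ty_share {A A₁ A₂ : Ty R} (hS : Share A A₁ A₂) : ty A₁ = ty A ∧ ty A₂ = ty A := by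
  induction hS <;> simp_all [ty]

theorem phiVal_eq_zero {A : Ty R} (hS : Share A A A) (v : Val R) : phiVal A v = 0 := by
  simpa using phiVal_share hS v

variable [IsStrictOrderedRing R]

/-- Nonnegativity at all values, not only well-typed ones, is what lets `HasTy.conseq` quantify over
arbitrary instantiations. -/
theorem phiVal_nonneg (A : Ty R) (v : Val R) : 0 ≤ phiVal A v := by
  induction A generalizing v with
  | unit => simp [phiVal]
  | list p A ih =>
    simp only [phiVal]
    induction v with
    | con i v₀ m vs _ ihs =>
      simp only [Val.fold]
      refine add_nonneg ?_ (Finset.sum_nonneg fun j _ => ?_)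
      · split_ifs
        exacts [add_nonneg (ih _) p.2, le_rfl]
      · split_ifs
        exacts [ihs j, le_rfl]
    | _ => simp [Val.fold]
  | sum A p B r ihA ihB =>
    cases v <;> simp only [phiVal, Val.fold, le_refl]
    simp only [Finset.sum_const_zero, add_zero]
    split_ifs
    exacts [add_nonneg (ihA _) p.2, add_nonneg (ihB _) r.2, le_rfl]
  | prod A B ihA ihB => exact add_nonneg (ihA _) (ihB _)
  | arrow => simp [phiVal]

end Phi

/-! ## The potential of a context -/

section CtxPot

variable {R : Type*} [CommRing R] [LinearOrder R]

/-- Renaming of a context. -/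
def renCtx (θ : ℕ → ℕ) (Γ : Ctx R) : Ctx R := Γ.map (fun b => (θ b.1, b.2))

theorem renCtx_congr {θ θ' : ℕ → ℕ} {Γ : Ctx R} (h : ∀ x ∈ dom Γ, θ x = θ' x) :
    renCtx θ Γ = renCtx θ' Γ :=
  List.map_congr_left fun b hb => by rw [h b.1 (mem_dom hb)]

/-- As a sum over the list, the potential is visibly invariant under permutation and additive under
concatenation, also when a name is repeated. -/
theorem eval_ctxPot (Γ : Ctx R) (ρ : ℕ → Val R) :
    (ctxPot Γ).eval ρ [] = (Γ.map (fun b => phiVal b.2 (ρ b.1))).sum := by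
  induction Γ with
  | nil => simp [ctxPot]
  | cons b Γ ih => simp [ctxPot, ih, eval_phi, Tm.eval]

theorem ctxPot_fv (Γ : Ctx R) {x : ℕ} (hx : x ∈ (ctxPot Γ).fv) : x ∈ dom Γ := by
  induction Γ with
  | nil => simp [ctxPot, Pot.zero, Pot.fv] at hx
  | cons b Γ ih =>
    rcases Finset.mem_union.1 hx with h | h
    · have := phi_fv _ _ h
      simp_all [Tm.fv, Var.fv, dom]
    · exact List.mem_cons_of_mem _ (ih h)

theorem potOk_ctxPot {Γ : Ctx R} {Δ : AmorNA.Ctx R} (h : pureCtx Γ ⊆ Δ) : PotOk Δ (ctxPot Γ) := by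
  induction Γ with
  | nil => exact .zero
  | cons b Γ ih =>
    simp only [pureCtx, List.map_cons, List.cons_subset] at h
    exact .add (potOk_phi_name h.1) (ih h.2)

theorem eval_ctxPot_nonneg [IsStrictOrderedRing R] (Γ : Ctx R) (ρ : ℕ → Val R) :
    0 ≤ (ctxPot Γ).eval ρ [] := by
  rw [eval_ctxPot]
  refine List.sum_nonneg fun r hr => ?_
  obtain ⟨b, _, rfl⟩ := List.mem_map.1 hr
  exact phiVal_nonneg _ _

end CtxPot

/-! ## The embedding -/

section Names

variable {R : Type*}

theorem Exp.nren_open {e : Exp R} {θ : ℕ → ℕ} {x x' : ℕ} (hx : x ∉ e.fv) :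
    (e.ren (openWith [x])).nren (Function.update θ x x') =
      (e.nren θ).ren (openWith [x']) := by
  rw [Exp.ren_nren e (θ' := θ) _ fun y hy => Function.update_of_ne (by rintro rfl; exact hx hy) _ _]
  congr 1
  funext n
  rcases n with _ | n <;> simp [openWith, Var.nren]

theorem Exp.nren_open₂ {e : Exp R} {θ : ℕ → ℕ} {x₁ x₂ y₁ y₂ : ℕ} (hx : x₁ ≠ x₂) (h₁ : x₁ ∉ e.fv)
    (h₂ : x₂ ∉ e.fv) :
    (e.ren (openWith [x₁, x₂])).nren (Function.update (Function.update θ x₁ y₁) x₂ y₂) =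
      (e.nren θ).ren (openWith [y₁, y₂]) := by
  rw [Exp.ren_nren e (θ' := θ) _ fun y hy => by
    rw [Function.update_of_ne (by rintro rfl; exact h₂ hy),
      Function.update_of_ne (by rintro rfl; exact h₁ hy)]]
  congr 1
  funext n
  rcases n with _ | _ | n <;> simp [openWith, Var.nren, hx]

theorem openWith_eq_dup (x : ℕ) : openWith [x, x] = dup (.free x) := by
  funext n
  rcases n with _ | _ | n <;> simp [openWith, dup]

variable [CommRing R] [LinearOrder R]

theorem renCtx_cons_update {θ : ℕ → ℕ} {Γ : Ctx R} {x x' : ℕ} {A : Ty R} (hx : x ∉ dom Γ) :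
    renCtx (Function.update θ x x') ((x, A) :: Γ) = (x', A) :: renCtx θ Γ := by
  rw [renCtx, List.map_cons, Function.update_self]
  congr 1
  exact renCtx_congr fun y hy => Function.update_of_ne (by rintro rfl; exact hx hy) _ _

theorem renCtx_cons_update₂ {θ : ℕ → ℕ} {Γ : Ctx R} {x₁ x₂ y₁ y₂ : ℕ} {A₁ A₂ : Ty R}
    (hx : x₁ ≠ x₂) (h₁ : x₁ ∉ dom Γ) (h₂ : x₂ ∉ dom Γ) :
    renCtx (Function.update (Function.update θ x₁ y₁) x₂ y₂) ((x₁, A₁) :: (x₂, A₂) :: Γ) =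
      (y₁, A₁) :: (y₂, A₂) :: renCtx θ Γ := by
  rw [renCtx, List.map_cons, List.map_cons, Function.update_self, Function.update_of_ne hx,
    Function.update_self]
  congr 2
  exact renCtx_congr fun y hy => by
    rw [Function.update_of_ne (by rintro rfl; exact h₂ hy),
      Function.update_of_ne (by rintro rfl; exact h₁ hy)]

theorem mem_fv_phi_name {A : Ty R} {x y : ℕ} (h : x ∈ (phi A (.name y)).fv) : x = y := by
  simpa [Tm.fv, Var.fv] using phi_fv _ _ h

theorem closed_cons {Δ : AmorNA.Ctx R} (hc : ∀ b ∈ Δ, b.2.fv = ∅) (x : ℕ) (A : Ty R) :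
    ∀ b ∈ (x, ty A) :: Δ, b.2.fv = ∅ := by
  simpa [ty_fv] using hc

theorem notMem_dom_cons {T : Type*} {Δ : List (ℕ × T)} {x y : ℕ} {t : T} (hxy : y ≠ x)
    (hy : y ∉ dom Δ) : y ∉ dom ((x, t) :: Δ) := by
  simpa [dom, hxy] using hy

theorem potOk_input {Γ : Ctx R} {Δ : AmorNA.Ctx R} (hΔ : pureCtx Γ ⊆ Δ) (q : R) :
    PotOk Δ ((ctxPot Γ).add (.const q)) := .add (potOk_ctxPot hΔ) (.const _ _)

theorem potOk_output (A : Ty R) (y : ℕ) (Δ : AmorNA.Ctx R) (q : R) :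
    PotOk ((y, ty A) :: Δ) ((Pot.const q).add (phi A (.name y))) :=
  .add (.const _ _) (potOk_phi_name (by simp))

/-- Removal of the only variable of the potential context. -/
theorem hasTy_erase {Δ : AmorNA.Ctx R} (hc : ∀ b ∈ Δ, b.2.fv = ∅) {f₁ f₂ : Pot R} {e : Tm R}
    {x y : ℕ} {T : AmorNA.Ty R} {A : Ty R} (h : HasTy [(x, T)] Δ f₁ e y f₂ (ty A))
    (hx₁ : x ∉ f₁.fv) (hx₂ : x ∉ f₂.fv) : HasTy [] Δ f₁ e y f₂ (ty A) := by
  have he : Ctx.erase [(x, T)] x = [] := by simp [Ctx.erase]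
  have := h.erase (x := x) (T' := T) (by simp) (by rw [he]; exact not_occurs (by simp) x)
    (not_occurs hc x) hx₁ (fun h => absurd h hx₂) (fun h => by simp [ty_fv] at h)
  rwa [he] at this

end Names

/-! ### Derived rules for the translated constructs, and the induction on AARA derivations -/

section Embedding

variable {R : Type*} [CommRing R] [LinearOrder R] [IsStrictOrderedRing R]

/-- A variable carries its potential to a fresh result binder. -/
theorem hasTy_name {Δ : AmorNA.Ctx R} {A : Ty R} {x y : ℕ} (hx : (x, ty A) ∈ Δ) (hy : y ∉ dom Δ) :
    HasTy [] Δ (Pot.zero.add (phi A (.name x))) (.name x) y (Pot.zero.add (phi A (.name y)))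
      (ty A) := by
  have hr := ((HasTy.var (Ω := []) hx).relax (f₃ := phi A (.name x))
    ⟨⟨by simp, .zero⟩, ⟨by simp, potOk_phi_name hx⟩, fun ρ _ => by
      simp [eval_phi, phiVal_nonneg]⟩).rename (y := y) ⟨by simp [dom], hy⟩
  simpa [ty_subst, Pot.add, Pot.subst, phi_subst, Tm.subst, Pot.zero] using hr

/-- The argument brings `r + Φ_x(A)` and the call consumes `a + Φ_x(A)`; the excess `r - a` joins
the result `b + Φ_y(B)`. -/
theorem hasTy_app {Δ : AmorNA.Ctx R} (hc : ∀ b ∈ Δ, b.2.fv = ∅) {f : Pot R} {e₁ e₂ : Tm R}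
    {y z : ℕ} {A B : Ty R} {a b r q : R} (hy : y ∉ dom Δ) (har : a ≤ r) (hq : q + a ≤ b + r)
    (h₁ : HasTy [] Δ .zero e₁ z .zero
      (.arrow (ty A) ((Pot.const a).add (phi A (.var (.bound 0))))
        (ty B) ((Pot.const b).add (phi B (.var (.bound 0))))))
    (h₂ : ∀ x ∉ dom Δ, HasTy [] Δ f e₂ x ((Pot.const r).add (phi A (.name x))) (ty A))
    (wf : PotOk Δ f) :
    HasTy [] Δ f (.app e₁ e₂) y ((Pot.const q).add (phi B (.name y))) (ty B) := by
  obtain ⟨x, hx⟩ := Infinite.exists_notMem_finset ((y :: dom Δ).toFinset ∪ f.fv)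
  simp only [Finset.mem_union, List.mem_toFinset, List.mem_cons, not_or] at hx
  obtain ⟨⟨hxy, hxΔ⟩, hxf⟩ := hx
  have hf (v : Var) : (phi A (.var v)).fv ⊆ v.fv := phi_fv _ _
  have ho (c : R) (C : Ty R) (x : ℕ) (xs : List ℕ) :
      ((Pot.const c).add (phi C (.var (.bound 0)))).ren (openWith (x :: xs)) =
        (Pot.const c).add (phi C (.name x)) := by
    simp [Pot.add, Pot.ren, phi_ren, Tm.ren, Var.ren, openWith]
  have hm : (x, ty A) ∈ [(x, ty A)] ++ Δ := by simp
  have wx := consistent_single (T := ty A) hxΔ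
  -- The result binder of the argument is `x` itself.
  have happ := HasTy.app (x := x) (y := y) ⟨by simp [dom], hxΔ⟩ ⟨by simp [dom], hy⟩ hxy
    (by simp [ty_fv, Pot.zero, Pot.add, Pot.fv, phi_bound_fv])
    (by simp [ty_fv, Pot.add, Pot.fv, phi_bound_fv]) h₁ (h₂ x hxΔ) (by
      rw [Pot.subst_self, Pot.subst_self, ho]
      refine ⟨⟨wx, .add (.const _ _) (potOk_phi_name hm)⟩,
        ⟨wx, .add .zero (.add (.const _ _) (potOk_phi_name hm))⟩, fun ρ _ => ?_⟩
      simpa using har)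
  rw [Pot.subst_self, ho, ho, ty_ren] at happ
  have hsub : Δ ⊆ [(x, ty A)] ++ Δ := List.subset_append_right _ _
  have hm' : (x, ty A) ∈ [(y, ty B), (x, ty A)] ++ Δ := by simp
  have hn' : (y, ty B) ∈ [(y, ty B), (x, ty A)] ++ Δ := by simp
  -- The two occurrences of `Φ_x(A)` in the output cancel in value. Only after consequence has
  -- replaced it by an output free of `x` can `x` be erased from the potential context.
  refine hasTy_erase hc (happ.conseq (F := f)
    (consistent_of_notMem (by simp [dom] at hy hxΔ ⊢; exact ⟨hy, hxΔ⟩))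
    (.add .zero (wf.mono hsub)) (wf.mono hsub)
    (.add (.sub (.add .zero (.add (.const _ _) (potOk_phi_name hm')))
      (.add (.const _ _) (potOk_phi_name hm'))) (.add (.const _ _) (potOk_phi_name hn')))
    (.add (.const _ _) (potOk_phi_name hn')) (fun ρ => by simp) (fun ρ => ?_)) hxf ?_
  · simp only [Pot.eval_add, Pot.eval_sub, Pot.eval_const, Pot.eval_zero]
    linarith
  · simp only [Pot.add, Pot.fv, Finset.mem_union, Finset.notMem_empty, false_or]
    exact fun h => hxy (mem_fv_phi_name h)

/-- The lazy tick. -/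
theorem hasTy_tickl {Δ : AmorNA.Ctx R} (hc : ∀ b ∈ Δ, b.2.fv = ∅) {f : Pot R} {e : Tm R} {y : ℕ}
    {A : Ty R} {r q c : R} (hy : y ∉ dom Δ) (hq₀ : 0 ≤ q) (hq : q + c ≤ r)
    (h : ∀ x ∉ dom Δ, HasTy [] Δ f e x ((Pot.const r).add (phi A (.name x))) (ty A))
    (wf : PotOk Δ f) :
    HasTy [] Δ f (.tickl c e) y ((Pot.const q).add (phi A (.name y))) (ty A) := by
  obtain ⟨x, hx⟩ := Infinite.exists_notMem_finset (y :: dom Δ).toFinset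
  simp only [List.mem_toFinset, List.mem_cons, not_or] at hx
  obtain ⟨hxy, hxΔ⟩ := hx
  -- The function `λx. tick c x` is given input `q + c + Φ_x(A)` and output `q + Φ_y(A)`; `q ≥ 0`
  -- makes its tick affordable for either sign of `c`.
  refine hasTy_app (a := q + c) (b := q) (z := y) hc hy hq (by linarith) ?_ h wf
  refine .abs (x := x) (y := y) ⟨by simp [dom], hxΔ⟩ ⟨by simp [dom], hy⟩ hxy
    (by simp [Tm.fv, Var.fv]) (by simp [ty_fv, Pot.add, Pot.fv, phi_bound_fv])
    (by simp [ty_fv, Pot.add, Pot.fv, phi_bound_fv]) ?_ ⟨by simp [dom], hy⟩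
  have hmem : (x, ty A) ∈ (x, ty A) :: Δ := by simp
  have hyn := notMem_dom_cons (t := ty A) (Ne.symm hxy) hy
  rw [ty_ren]
  simp only [Pot.add, Pot.ren, phi_ren, Tm.ren, Var.ren, openWith, List.getElem?_cons_zero]
  refine (hasTy_name hmem hyn).tick (consistent_single hyn)
    (.add .zero (potOk_phi_name hmem)) (.add (.const _ _) (potOk_phi_name hmem))
    (.add .zero (potOk_phi_name (by simp))) (.add (.const _ _) (potOk_phi_name (by simp))) ?_ ?_
  · intro ρ
    change (Pot.add _ _).eval ρ [] + c ≤ (Pot.add _ _).eval ρ []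
    simp only [Pot.eval_add, Pot.eval_zero, Pot.eval_const]
    linarith
  · intro ρ
    change (Pot.add _ _).eval ρ [] + (Pot.add _ _).eval ρ [] + c ≤
      (Pot.add _ _).eval ρ [] + (Pot.add _ _).eval ρ []
    simp only [Pot.eval_add, Pot.eval_zero, Pot.eval_const]
    linarith

/-- The potential `f'` is both what `e₁` leaves and what `e₂` needs, so the excess in TLet is `f' -
f' = 0`. It may mention `x`; `f` and `g` may not, so that `x` can be erased. -/
theorem hasTy_letE {Δ : AmorNA.Ctx R} (hc : ∀ b ∈ Δ, b.2.fv = ∅) {f f' g : Pot R} {e₁ e₂ : Tm R}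
    {x y : ℕ} {A B : Ty R} (hx : x ∉ dom Δ) (hy : y ∉ dom Δ) (hxe : x ∉ e₂.fv)
    (hxf : x ∉ f.fv) (hxg : x ∉ g.fv) (h₁ : HasTy [] Δ f e₁ x f' (ty A))
    (h₂ : HasTy [] ((x, ty A) :: Δ) f' (e₂.ren (openWith [x])) y g (ty B))
    (wf : PotOk Δ f) (wf' : PotOk ((x, ty A) :: Δ) f') (wg : PotOk ((y, ty B) :: Δ) g) :
    HasTy [] Δ f (.letE e₁ e₂) y g (ty B) := by
  have hlet := HasTy.letE ⟨by simp [dom], hx⟩ hxe h₁ h₂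
    ⟨⟨by simp, wf'⟩, ⟨by simp, by rwa [Pot.subst_self]⟩, fun ρ _ => by rw [Pot.subst_self]⟩
  rw [Pot.subst_self] at hlet
  have hsub : (x, ty A) :: Δ ⊆ [(y, ty B), (x, ty A)] ++ Δ := List.subset_cons_self _ _
  have wg' : PotOk ([(y, ty B), (x, ty A)] ++ Δ) g :=
    wg.mono (List.cons_subset_cons _ (List.subset_cons_self _ _))
  have wf₁ : PotOk ([(x, ty A)] ++ Δ) f := wf.mono (List.subset_append_right _ _)
  exact hasTy_erase hc (hlet.conseq
    (consistent_of_notMem (by simp [dom] at hx hy ⊢; exact ⟨hy, hx⟩)) wf₁ wf₁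
    (.add (.sub (wf'.mono hsub) (wf'.mono hsub)) wg') wg' (fun ρ => le_rfl)
    (fun ρ => by simp)) hxf hxg

/-- TCons compares the output at `C_i(…)` with the sum of the component potentials, which is `hle`
at the level of values. The constant `q` has no sign condition. -/
theorem hasTy_con {Δ : AmorNA.Ctx R} {n : ℕ} {T : Fin n → AmorNA.Ty R} {m : Fin n → ℕ} (i : Fin n)
    {A C : Ty R} (hT : ty C = .ind n T m) (hA : T i = ty A) {f : Pot R} {f' : Fin (m i) → Pot R}
    {e : Tm R} {e' : Fin (m i) → Tm R} {y : ℕ} {q s : R} (hy : y ∉ dom Δ)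
    (h : ∀ x ∉ dom Δ, HasTy [] Δ f e x ((Pot.const s).add (phi A (.name x))) (ty A))
    (h' : ∀ j, ∀ x ∉ dom Δ, HasTy [] Δ (f' j) (e' j) x (Pot.zero.add (phi C (.name x))) (ty C))
    (hle : ∀ v vs, q + phiVal C (.con i v (m i) vs) ≤ s + phiVal A v + ∑ j, phiVal C (vs j)) :
    HasTy [] Δ (f.add (.sum f')) (.con i e (m i) e') y ((Pot.const q).add (phi C (.name y)))
      (ty C) := by
  obtain ⟨N, hN⟩ := exists_bound (dom Δ).toFinset
  simp only [List.mem_toFinset] at hN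
  set L : AmorNA.Ctx R :=
    (N + 0, T i) :: List.ofFn (fun j : Fin (m i) => (N + (j + 1), AmorNA.Ty.ind n T m)) with hL
  have hL₀ : (N + 0, ty A) ∈ L ++ Δ := by simp [hL, hA]
  have hLj (j : Fin (m i)) : (N + (j + 1), ty C) ∈ L ++ Δ := by
    rw [hT]
    exact List.mem_append_left _ (List.mem_cons_of_mem _ (List.mem_ofFn.2 ⟨j, rfl⟩))
  have hcons : ∀ x T₁ T₂, (x, T₁) ∈ L ++ [] → (x, T₂) ∈ Δ → T₁ = T₂ := by
    refine consistent_of_notMem fun x hx => ?_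
    rw [List.append_nil] at hx
    obtain ⟨b, hb, rfl⟩ := List.mem_map.1 hx
    rcases List.mem_cons.1 hb with rfl | hb
    · exact hN _
    · obtain ⟨j, rfl⟩ := List.mem_ofFn.1 hb
      exact hN _
  have wy := consistent_single (T := .ind n T m) hy
  have harg : ArgTy (L ++ Δ) (.con i (.name (N + 0)) (m i) fun j => .name (N + (j + 1))) (ty C) := by
    rw [hT]
    exact .con i (.var (hA ▸ hL₀)) fun j => .var (hT ▸ hLj j)
  have hs : ((Pot.const q).add (phi C (.name y))).subst y
        (.con i (.name (N + 0)) (m i) fun j => .name (N + (j + 1))) =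
      (Pot.const q).add (phi C (.con i (.name (N + 0)) (m i) fun j => .name (N + (j + 1)))) := by
    simp [Pot.add, Pot.subst, phi_subst, Tm.subst]
  rw [hT]
  refine HasTy.con i (x₀ := N + 0) (x := fun j => N + (j + 1)) ⟨by simp [dom], hy⟩
    (hA ▸ h _ (hN _)) (fun j => hT ▸ h' j _ (hN _)) (fun j hj => by omega)
    (fun j k hjk hj => absurd (Fin.ext (by omega)) hjk) ⟨wy, hT ▸ potOk_output C y Δ q⟩ ?_
  rw [hs]
  refine ⟨⟨hcons, .add (.const _ _) ?_⟩, ⟨hcons, .add (.add (.const _ _) ?_) (PotOk.sum fun j =>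
    .add .zero ?_)⟩, fun ρ _ => ?_⟩
  · rw [List.append_nil]; exact potOk_phi C harg
  · rw [List.append_nil]; exact potOk_phi_name hL₀
  · rw [List.append_nil]; exact potOk_phi_name (hLj j)
  · simpa [Pot.eval_sum, eval_phi, Tm.eval] using
      hle (ρ (N + 0)) (fun j => ρ (N + (j + 1)))

/-- The scrutinee is a variable, so its potential passes to its result binder, and substituting
`C_i(…)` there hands each branch the potential of the constructor. The rest, `f`, is carried as a
frame and must be nonnegative. -/
theorem hasTy_case {Δ : AmorNA.Ctx R} {n : ℕ} {T : Fin n → AmorNA.Ty R} {m : Fin n → ℕ}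
    {B C : Ty R} (hT : ty C = .ind n T m) {f g : Pot R} {e : Fin n → Tm R} {x y : ℕ}
    (hx : (x, ty C) ∈ Δ) (wf : PotOk Δ f) (hf : f.fv ⊆ (dom Δ).toFinset)
    (hf₀ : ∀ ρ, 0 ≤ f.eval ρ [])
    (h : ∀ i (x₀ : ℕ) (xr : Fin (m i) → ℕ), (x₀ :: List.ofFn xr).Nodup →
      (∀ z ∈ x₀ :: List.ofFn xr, z ∉ dom Δ ∧ z ≠ y) →
      HasTy [] ((x₀, T i) :: List.ofFn (fun j => (xr j, ty C)) ++ Δ)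
        ((phi C (.con i (.name x₀) (m i) fun j => .name (xr j))).add f)
        ((e i).ren (openWith (x₀ :: List.ofFn xr))) y g (ty B)) :
    HasTy [] Δ ((phi C (.name x)).add f) (.case (.name x) n m e) y g (ty B) := by
  obtain ⟨N, hN⟩ := exists_bound
    (insert y (dom Δ).toFinset ∪ g.fv ∪ Finset.univ.biUnion fun i => (e i).fv)
  simp only [Finset.mem_union, Finset.mem_insert, List.mem_toFinset, Finset.mem_biUnion,
    Finset.mem_univ, true_and, not_or, not_exists] at hN
  have hz : N + 0 ∉ dom Δ := (hN 0).1.1.2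
  have hzf : N + 0 ∉ f.fv := fun h => hz (by simpa using hf h)
  have hsub : Δ ⊆ (N + 0, ty C) :: Δ := List.subset_cons_self _ _
  have h₀ : HasTy [] Δ ((phi C (.name x)).add f) (.name x) (N + 0)
      ((phi C (.name (N + 0))).add f) (ty C) := by
    refine (hasTy_name hx hz).conseq (consistent_single hz) (.add .zero (potOk_phi_name hx))
      (.add (potOk_phi_name hx) wf) (.add .zero (potOk_phi_name (by simp)))
      (.add (potOk_phi_name (by simp)) (wf.mono hsub)) (fun ρ => ?_) (fun ρ => ?_)
    all_goals
      have := hf₀ ρ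
      simp only [Pot.eval_add, Pot.eval_zero]
      linarith
  have hmem (i : Fin n) (z : ℕ) (hz : z ∈ (N + 0) :: List.ofFn fun j : Fin (m i) => N + (j + 1)) :
      ∃ k, z = N + k := by
    rcases List.mem_cons.1 hz with rfl | hz
    · exact ⟨0, rfl⟩
    · obtain ⟨j, rfl⟩ := List.mem_ofFn.1 hz
      exact ⟨_, rfl⟩
  have hnd (i : Fin n) : ((N + 0) :: List.ofFn fun j : Fin (m i) => N + (j + 1)).Nodup := by
    refine List.nodup_cons.2 ⟨fun h => ?_, List.nodup_ofFn.2 fun j k hjk => Fin.ext ?_⟩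
    · obtain ⟨j, hj⟩ := List.mem_ofFn.1 h
      omega
    · simpa using hjk
  -- The name `N + 0` serves both as the scrutinee's result binder and as `x_0` in every branch. The
  -- substitution does not touch `f`, where `N + 0` is not free.
  refine HasTy.des (x₀ := fun _ => N + 0) (xr := fun i j => N + (j + 1)) (hT ▸ h₀) hnd
    (fun i z hz => ?_) (fun i => ?_)
  · obtain ⟨k, rfl⟩ := hmem i z hz
    exact ⟨⟨by simp [dom], (hN k).1.1.2⟩, (hN k).2 i, (hN k).1.2, by simp [ty_fv]⟩
  · have := h i (N + 0) (fun j => N + (j + 1)) (hnd i) fun z hz => by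
      obtain ⟨k, rfl⟩ := hmem i z hz
      exact ⟨(hN k).1.1.2, (hN k).1.1.1⟩
    rw [hT] at this
    convert this using 1
    have hfz := Pot.subst_of_notMem f
      (.con i (.name (N + 0)) (m i) fun j => .name (N + (j + 1))) hzf
    simpa [Pot.add, Pot.subst, phi_subst, Tm.subst] using hfz


/-- The freedom in `θ` covers opened binders and shared variables, that in `Δ` the structural rules
and the locally bound variables, and that in `y` the choice of binders in premises. Closed types in
`Δ` are required by TErase. -/
theorem embedding {K : Costs R} {Γ : Ctx R} {q q' : NN R} {e : Exp R} {A : Ty R}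
    (hD : Judg K Γ q q' e A) (θ : ℕ → ℕ) {Δ : AmorNA.Ctx R} (hΔ : pureCtx (renCtx θ Γ) ⊆ Δ)
    (hc : ∀ b ∈ Δ, b.2.fv = ∅) {y : ℕ} (hy : y ∉ dom Δ) :
    HasTy [] Δ ((ctxPot (renCtx θ Γ)).add (.const q)) (h K (e.nren θ)) y
      ((Pot.const (q' : R)).add (phi A (.name y))) (ty A) := by
  induction hD generalizing θ Δ y with
  | @var q q' A x hq =>
    have hm : (θ x, ty A) ∈ Δ := by simpa [renCtx, pureCtx] using hΔ
    simp only [Exp.nren, Var.nren, h]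
    refine (hasTy_name hm hy).tick (consistent_single hy) (.add .zero (potOk_phi_name hm))
      (potOk_input hΔ q) (.add .zero (potOk_phi_name (by simp))) (potOk_output _ _ _ _)
      (fun ρ => ?_) (fun ρ => ?_)
    all_goals
      have := q'.2
      simp [renCtx, ctxPot]
      linarith
  | @unit q q' hq =>
    simp only [Exp.nren, h]
    refine (HasTy.unit ⟨by simp [dom], hy⟩).tick (consistent_single hy) .zero
      (potOk_input hΔ q) .zero (potOk_output .unit _ _ _) (fun ρ => ?_) (fun ρ => ?_)
    all_goals
      have := q'.2
      simp [renCtx, ctxPot, phi]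
      linarith
  | @tick q q' t hq =>
    simp only [Exp.nren, h]
    refine (HasTy.unit ⟨by simp [dom], hy⟩).tick (consistent_single hy) .zero
      (potOk_input hΔ q) .zero (potOk_output .unit _ _ _) (fun ρ => ?_) (fun ρ => ?_)
    all_goals
      have := q'.2
      simp [renCtx, ctxPot, phi]
      linarith
  | @relax Γ q q' p p' e A _ hq hqq ih =>
    refine (ih θ hΔ hc hy).conseq (consistent_single hy) (potOk_input hΔ _) (potOk_input hΔ _) (potOk_output _ _ _ _)
      (potOk_output _ _ _ _) (fun ρ => ?_) (fun ρ => ?_)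
    all_goals
      simp only [Pot.eval_add, Pot.eval_const]
      linarith
  | @weak Γ q q' e A B x hx _ ih =>
    -- The type context stays `Δ`; only the potential of the extra variable has to be discarded, by
    -- nonnegativity.
    have hΔ' : pureCtx (renCtx θ Γ) ⊆ Δ := List.Subset.trans (List.subset_cons_self _ _) hΔ
    refine (ih θ hΔ' hc hy).conseq (consistent_single hy) (potOk_input hΔ' _) (potOk_input hΔ _) (potOk_output _ _ _ _)
      (potOk_output _ _ _ _) (fun ρ => ?_) (fun ρ => ?_)
    all_goals
      have := phiVal_nonneg A (ρ (θ x))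
      simp [renCtx, ctxPot, eval_phi, Tm.eval]
      linarith
  | @exch Γ Γ' q q' e A hp _ ih =>
    have hΔ' : pureCtx (renCtx θ Γ) ⊆ Δ :=
      List.Subset.trans (List.map_subset _ (List.map_subset _ hp.subset)) hΔ
    have he (ρ : ℕ → Val R) : (ctxPot (renCtx θ Γ)).eval ρ [] = (ctxPot (renCtx θ Γ')).eval ρ [] := by
      rw [eval_ctxPot, eval_ctxPot]
      exact ((hp.map _).map _).sum_eq
    refine (ih θ hΔ' hc hy).conseq (consistent_single hy) (potOk_input hΔ' _) (potOk_input hΔ _) (potOk_output _ _ _ _)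
      (potOk_output _ _ _ _) (fun ρ => ?_) (fun ρ => ?_)
    all_goals
      simp only [Pot.eval_add, Pot.eval_const, he]
      linarith
  | @share Γ q q' e A A₁ A₂ B x x₁ x₂ hS hx h₁ h₂ h₁₂ hf₁ hf₂ _ ih =>
    -- Both shares are renamed to `θ x`, so this name occurs twice in the renamed context, with
    -- annotations adding up to those of `A`.
    have hr := renCtx_cons_update₂ (θ := θ) (y₁ := θ x) (y₂ := θ x) (A₁ := A₁) (A₂ := A₂) h₁₂ h₁ h₂
    have hΔ' : pureCtx ((θ x, A₁) :: (θ x, A₂) :: renCtx θ Γ) ⊆ Δ := by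
      simpa [renCtx, pureCtx, ty_share hS] using hΔ
    have hi := ih (Function.update (Function.update θ x₁ (θ x)) x₂ (θ x)) (by rwa [hr]) hc hy
    rw [hr, Exp.nren_open₂ h₁₂ hf₁ hf₂, openWith_eq_dup] at hi
    simp only [Exp.nren, Var.nren, h]
    refine hi.conseq (consistent_single hy) (potOk_input hΔ' _) (potOk_input hΔ _)
      (potOk_output _ _ _ _) (potOk_output _ _ _ _) (fun ρ => ?_) (fun ρ => ?_)
    all_goals
      have := phiVal_share hS (ρ (θ x))
      simp [renCtx, ctxPot, eval_phi, Tm.eval]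
      linarith
  | @nil q q' p A hq =>
    simp only [Exp.nren, h]
    have hcon := hasTy_con (C := .list p A) (A := .unit) (f := .zero) (f' := fun _ => .zero)
      (e := .unit) (e' := Fin.elim0) (q := 0) (s := 0) (0 : Fin 2) rfl rfl hy
      (fun x hx => (HasTy.unit ⟨by simp [dom], hx⟩).conseq (F := .zero) (consistent_single hx) .zero .zero .zero
        (potOk_output .unit _ _ _) (fun ρ => le_rfl) (fun ρ => by simp [phi]))
      (fun j => j.elim0) (fun v vs => by
        have hz : ∑ j, phiVal (.list p A) (vs j) = 0 := Finset.sum_eq_zero fun j _ => j.elim0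
        rw [hz]
        exact (by simp [phiVal, Val.fold] : 0 + phiVal (.list p A) (.con 0 v 0 vs) ≤ 0 + phiVal .unit v + 0))
    refine hcon.tick (consistent_single hy) (.add .zero (.sum fun _ => .zero)) (potOk_input hΔ _)
      (potOk_output (.list p A) _ _ _) (potOk_output (.list p A) _ _ _) (fun ρ => ?_) (fun ρ => ?_)
    all_goals
      have := q'.2
      simp [renCtx, ctxPot, Pot.eval_sum]
      linarith
  | @cons q q' p A x₁ x₂ hx hq =>
    simp only [Exp.nren, Var.nren, h]
    have hm : (θ x₁, ty A) ∈ Δ ∧ (θ x₂, ty (.list p A)) ∈ Δ := by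
      simpa [renCtx, pureCtx] using hΔ
    -- Before the tick, the components lack the `p` units of the new cell, so the output constant is
    -- `-p`; the input `q` of the rule makes up for it in the consequence step of `HasTy.tick`.
    have hcon := hasTy_con (C := .list p A) (A := A) (f := Pot.zero.add (phi A (.name (θ x₁))))
      (f' := fun _ => Pot.zero.add (phi (.list p A) (.name (θ x₂))))
      (e := .name (θ x₁)) (e' := fun _ => .name (θ x₂)) (q := -p) (s := 0) (1 : Fin 2) rfl rfl hy
      (fun x hx => hasTy_name hm.1 hx) (fun j x hx => hasTy_name hm.2 hx)
      (fun v vs => by simp [phiVal, Val.fold]; linarith)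
    refine hcon.tick (consistent_single hy) ?_ (potOk_input hΔ _)
      (potOk_output (.list p A) _ _ _) (potOk_output (.list p A) _ _ _) (fun ρ => ?_) (fun ρ => ?_)
    · exact .add (.add .zero (potOk_phi_name hm.1)) (.sum fun _ => .add .zero (potOk_phi_name hm.2))
    all_goals
      have := q'.2
      have := p.2
      simp [renCtx, ctxPot, Pot.eval_sum]
      linarith
  | @left Γ q q' s s' p r e A B hq _ hs ih =>
    simp only [Exp.nren, h]
    have hcon := hasTy_con (C := .sum A p B r) (A := A) (f' := fun _ => .zero)
      (e' := Fin.elim0) (q := q') (s := s') (0 : Fin 2) rfl rfl hy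
      (fun x hx => ih θ hΔ hc hx) (fun j => j.elim0)
      (fun v vs => by
        have hz : ∑ j, phiVal (.sum A p B r) (vs j) = 0 := Finset.sum_eq_zero fun j _ => j.elim0
        rw [hz]
        simp [phiVal, Val.fold]
        linarith)
    refine hcon.tick (consistent_single hy) (.add (potOk_input hΔ _) (.sum fun _ => .zero))
      (potOk_input hΔ _) (potOk_output (.sum A p B r) _ _ _) (potOk_output (.sum A p B r) _ _ _)
      (fun ρ => ?_) (fun ρ => ?_)
    all_goals
      simp [Pot.eval_sum]
      linarith
  | @right Γ q q' s s' p r e A B hq _ hs ih =>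
    simp only [Exp.nren, h]
    have hcon := hasTy_con (C := .sum A p B r) (A := B) (f' := fun _ => .zero)
      (e' := Fin.elim0) (q := q') (s := s') (1 : Fin 2) rfl rfl hy
      (fun x hx => ih θ hΔ hc hx) (fun j => j.elim0)
      (fun v vs => by
        have hz : ∑ j, phiVal (.sum A p B r) (vs j) = 0 := Finset.sum_eq_zero fun j _ => j.elim0
        rw [hz]
        simp [phiVal, Val.fold]
        linarith)
    refine hcon.tick (consistent_single hy) (.add (potOk_input hΔ _) (.sum fun _ => .zero))
      (potOk_input hΔ _) (potOk_output (.sum A p B r) _ _ _) (potOk_output (.sum A p B r) _ _ _)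
      (fun ρ => ?_) (fun ρ => ?_)
    all_goals
      simp [Pot.eval_sum]
      linarith
  | @app q q' p p' A B x₁ x₂ hx hq hqq =>
    simp only [Exp.nren, Var.nren, h]
    have hm : (θ x₁, ty (.arrow A p p' B)) ∈ Δ ∧ (θ x₂, ty A) ∈ Δ := by
      simpa [renCtx, pureCtx] using hΔ
    -- What remains after paying `c_App` all travels with the argument: the function carries no
    -- potential.
    have wf : PotOk Δ ((phi A (.name (θ x₂))).add (.const (q - K.cApp))) :=
      .add (potOk_phi_name hm.2) (.const _ _)
    have happ := hasTy_app (a := p) (b := p') (r := q - K.cApp) (q := q') hc hy (by linarith)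
      (by linarith) (HasTy.var hm.1) (fun x hx => (hasTy_name hm.2 hx).conseq
        (consistent_single hx) (.add .zero (potOk_phi_name hm.2)) wf
        (.add .zero (potOk_phi_name (by simp))) (potOk_output _ _ _ _)
        (fun ρ => by
          have := p.2
          simp only [Pot.eval_add, Pot.eval_zero, Pot.eval_const]; linarith)
        (fun ρ => by simp only [Pot.eval_add, Pot.eval_zero, Pot.eval_const]; linarith)) wf
    refine happ.tick (consistent_single hy) wf (potOk_input hΔ _) (potOk_output _ _ _ _)
      (potOk_output _ _ _ _) (fun ρ => ?_) (fun ρ => ?_)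
    all_goals
      simp [renCtx, ctxPot, phi]
      linarith
  | @letE Γ₁ Γ₂ q q' p p' r r' e₁ e₂ A B x hd hx₁ hx₂ hx hq _ hp _ hr ih₁ ih₂ =>
    simp only [Exp.nren, h]
    have he : renCtx θ (Γ₁ ++ Γ₂) = renCtx θ Γ₁ ++ renCtx θ Γ₂ := List.map_append
    have hev (ρ : ℕ → Val R) : (ctxPot (renCtx θ Γ₁ ++ renCtx θ Γ₂)).eval ρ [] =
        (ctxPot (renCtx θ Γ₁)).eval ρ [] + (ctxPot (renCtx θ Γ₂)).eval ρ [] := by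
      simp [eval_ctxPot]
    rw [he] at hΔ ⊢
    have hΔ' : pureCtx (renCtx θ Γ₁) ⊆ Δ ∧ pureCtx (renCtx θ Γ₂) ⊆ Δ := by
      simpa [pureCtx] using hΔ
    -- The constant `r'` exists only after the body is evaluated; it pays `c_{Let_3}` and leaves
    -- `q'`.
    refine hasTy_tickl (r := r') hc hy q'.2 hr (fun z hz => ?_) (potOk_input hΔ _)
    obtain ⟨v, hv⟩ := Infinite.exists_notMem_finset ((z :: dom Δ).toFinset ∪
      (Tm.tick K.cLet₂ (h K (e₂.nren θ))).fv ∪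
        ((ctxPot (renCtx θ Γ₁ ++ renCtx θ Γ₂)).add (.const q)).fv)
    simp only [Finset.mem_union, List.mem_toFinset, List.mem_cons, not_or] at hv
    obtain ⟨⟨⟨hvz, hvΔ⟩, hve⟩, hvf⟩ := hv
    have hzv := notMem_dom_cons (t := ty A) (Ne.symm hvz) hz
    have hΔv : pureCtx ((v, A) :: renCtx θ Γ₂) ⊆ (v, ty A) :: Δ :=
      List.cons_subset_cons _ hΔ'.2
    have h₁ := ih₁ θ hΔ'.1 hc hvΔ
    have h₂ := ih₂ (Function.update θ x v) (by rwa [renCtx_cons_update hx₂])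
      (closed_cons hc v A) hzv
    rw [renCtx_cons_update hx₂, Exp.nren_open hx, h_ren] at h₂
    -- The potential of `Γ₂` is carried through `e₁` as a frame, so the intermediate potential is
    -- that of `v` and `Γ₂`, plus `p'`.
    refine hasTy_letE hc hvΔ hz hve hvf ?_
      (h₁.tick (F := (ctxPot (renCtx θ Γ₁ ++ renCtx θ Γ₂)).add (.const q))
        (G := (ctxPot ((v, A) :: renCtx θ Γ₂)).add (.const p'))
        (consistent_single hvΔ) (potOk_input hΔ'.1 _) (potOk_input hΔ _) (potOk_output _ _ _ _)
        (potOk_input hΔv _) (fun ρ => ?_) (fun ρ => ?_))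
      (h₂.tick (F := (ctxPot ((v, A) :: renCtx θ Γ₂)).add (.const p'))
        (consistent_single hzv) (potOk_input hΔv _) (potOk_input hΔv _)
        (potOk_output _ _ _ _) (potOk_output _ _ _ _) (fun ρ => ?_) (fun ρ => ?_))
      (potOk_input hΔ _) (potOk_input hΔv _) (potOk_output _ _ _ _)
    · simp only [Pot.add, Pot.fv, Finset.mem_union, Finset.notMem_empty, false_or]
      exact fun h => hvz (mem_fv_phi_name h)
    all_goals
      have := eval_ctxPot_nonneg (renCtx θ Γ₂) ρ
      simp only [Pot.eval_add, Pot.eval_const, hev, ctxPot]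
      linarith
  | @func Γ q q' p p' e A B f x hS hf hx hxf hfe hxe _ hq ih =>
    simp only [Exp.nren, h]
    obtain ⟨g, hg⟩ := Infinite.exists_notMem_finset ((y :: dom Δ).toFinset ∪
      (Tm.lam (h K (e.nren θ))).fv)
    simp only [Finset.mem_union, List.mem_toFinset, List.mem_cons, not_or] at hg
    obtain ⟨⟨hgy, hgΔ⟩, hge⟩ := hg
    obtain ⟨z, hz⟩ := Infinite.exists_notMem_finset ((g :: y :: dom Δ).toFinset ∪
      ((h K (e.nren θ)).ren (lift 1 (openWith [g]))).fv)
    simp only [Finset.mem_union, List.mem_toFinset, List.mem_cons, not_or] at hz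
    obtain ⟨⟨hzg, hzy, hzΔ⟩, hze⟩ := hz
    have hyg := notMem_dom_cons (t := ty (.arrow A p p' B)) (Ne.symm hgy) hy
    have hzg' := notMem_dom_cons (t := ty (.arrow A p p' B)) hzg hzΔ
    have hyz := notMem_dom_cons (t := ty A) (Ne.symm hzy) hyg
    have hr := renCtx_cons_update₂ (θ := θ) (y₁ := z) (y₂ := g) (A₁ := A)
      (A₂ := .arrow A p p' B) hxf hx hf
    have hΔ' : pureCtx ((z, A) :: (g, .arrow A p p' B) :: renCtx θ Γ) ⊆
        (z, ty A) :: (g, ty (.arrow A p p' B)) :: Δ :=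
      List.cons_subset_cons _ (List.cons_subset_cons _ hΔ)
    have hi := ih (Function.update (Function.update θ x z) f g) (by rwa [hr])
      (closed_cons (closed_cons hc g (.arrow A p p' B)) z A) hyz
    rw [hr, Exp.nren_open₂ hxf hxe hfe, h_ren] at hi
    -- A self-shared type has no potential, so the closure captures none and TFix and TAbs apply
    -- with zero input.
    have hΓ (ρ : ℕ → Val R) : (ctxPot (renCtx θ Γ)).eval ρ [] = 0 := by
      rw [eval_ctxPot, renCtx, List.map_map]
      refine List.sum_eq_zero fun r hr => ?_
      obtain ⟨b, hb, rfl⟩ := List.mem_map.1 hr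
      exact phiVal_eq_zero (hS b.1 b.2 hb) _
    have hzm : (z, ty A) ∈ (z, ty A) :: (g, ty (.arrow A p p' B)) :: Δ := by simp
    have hbody := hi.conseq (F := (Pot.const (p : R)).add (phi A (.name z)))
      (G := (Pot.const (p' : R)).add (phi B (.name y))) (consistent_single hyz)
      (potOk_input hΔ' _) (.add (.const _ _) (potOk_phi_name hzm)) (potOk_output _ _ _ _)
      (potOk_output _ _ _ _)
      (fun ρ => by simp only [Pot.eval_add, Pot.eval_const, ctxPot, hΓ, phi, Pot.eval_zero]; linarith)
      (fun ρ => by simp only [Pot.eval_add, Pot.eval_const, ctxPot, hΓ, phi, Pot.eval_zero]; linarith)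
    have hlam : HasTy [] ((g, ty (.arrow A p p' B)) :: Δ) .zero
        ((Tm.lam (h K (e.nren θ))).ren (openWith [g])) y .zero (ty (.arrow A p p' B)) := by
      refine .abs (x := z) (y := y) ⟨by simp [dom], hzg'⟩ ⟨by simp [dom], hyg⟩ hzy hze
        (by simp [ty_fv, Pot.add, Pot.fv, phi_bound_fv])
        (by simp [ty_fv, Pot.add, Pot.fv, phi_bound_fv]) ?_ ⟨by simp [dom], hyg⟩
      rw [Tm.open_open, ty_ren]
      simpa only [Pot.add, Pot.ren, phi_ren, Tm.ren, Var.ren, openWith,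
        List.getElem?_cons_zero] using hbody
    refine (HasTy.fix (z := y) ⟨by simp [dom], hy⟩ ⟨by simp [dom], hgΔ⟩ hge
      (by simp [ty_fv]) hlam).tick (consistent_single hy) .zero (potOk_input hΔ _) .zero
      (potOk_output (.arrow A p p' B) _ _ _) (fun ρ => ?_) (fun ρ => ?_)
    all_goals
      have := q'.2
      simp only [Pot.eval_add, Pot.eval_const, hΓ, phi, Pot.eval_zero]
      linarith
  | @matchSum Γ q q' s₁ s₂ p r e₁ e₂ A B C x x₁ x₂ hx hx₁ hx₂ hf₁ hf₂ hq₁ _ hq₂ _ ih₁ ih₂ =>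
    simp only [Exp.nren, Var.nren, h]
    have hm : (θ x, ty (.sum A p B r)) ∈ Δ ∧ pureCtx (renCtx θ Γ) ⊆ Δ := by
      simpa [renCtx, pureCtx] using hΔ
    have hcase := hasTy_case (C := .sum A p B r) (T := ![ty A, ty B]) (m := ![0, 0]) (B := C)
      (e := ![.tick K.cCaseLeft (h K (e₁.nren θ)), .tick K.cCaseRight (h K (e₂.nren θ))])
      (g := (Pot.const (q' : R)).add (phi C (.name y))) (y := y) rfl hm.1
      (potOk_input hm.2 q) (fun z hz => ?_) (fun ρ => ?_) (fun i x₀ xr hnd hfr => ?_)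
    · refine hcase.conseq (consistent_single hy) (.add (potOk_phi_name hm.1) (potOk_input hm.2 _))
        (potOk_input hΔ _) (potOk_output _ _ _ _) (potOk_output _ _ _ _) (fun ρ => ?_) (fun ρ => ?_)
      all_goals
        simp only [Pot.eval_add, Pot.eval_const, renCtx, List.map_cons, ctxPot]
        linarith
    · have := ctxPot_fv (Γ := renCtx θ Γ) (x := z) (by simpa [Pot.add, Pot.fv] using hz)
      exact List.mem_toFinset.2 (dom_mono hm.2 (by simpa [pureCtx, dom] using this))
    · exact add_nonneg (eval_ctxPot_nonneg _ _) q.2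
    · have hfr₀ := hfr x₀ (by simp)
      fin_cases i
      · have hyx := notMem_dom_cons (t := ty A) (Ne.symm hfr₀.2) hy
        have hΔ' : pureCtx ((x₀, A) :: renCtx θ Γ) ⊆ (x₀, ty A) :: Δ :=
          List.cons_subset_cons _ hm.2
        have hi := ih₁ (Function.update θ x₁ x₀) (by rwa [renCtx_cons_update hx₁])
          (closed_cons hc x₀ A) hyx
        rw [renCtx_cons_update hx₁, Exp.nren_open hf₁, h_ren] at hi
        -- The potential of `left(x₀)` evaluates to that of `x₀` plus `p`, which is the `p` on the
        -- left of the AARA premise.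
        refine hi.tick (consistent_single hyx) (potOk_input hΔ' _)
          (.add (potOk_phi (.sum A p B r) (.con (T := ![ty A, ty B]) (m := ![0, 0]) (0 : Fin 2)
            (.var List.mem_cons_self) fun j => j.elim0))
            (potOk_input (List.Subset.trans hm.2 (List.subset_cons_self _ _)) _))
          (potOk_output _ _ _ _) (potOk_output _ _ _ _) (fun ρ => ?_) (fun ρ => ?_)
        all_goals
          simp [ctxPot, eval_phi, Tm.eval, phiVal, Val.fold]
          linarith
      · have hyx := notMem_dom_cons (t := ty B) (Ne.symm hfr₀.2) hy
        have hΔ' : pureCtx ((x₀, B) :: renCtx θ Γ) ⊆ (x₀, ty B) :: Δ :=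
          List.cons_subset_cons _ hm.2
        have hi := ih₂ (Function.update θ x₂ x₀) (by rwa [renCtx_cons_update hx₂])
          (closed_cons hc x₀ B) hyx
        rw [renCtx_cons_update hx₂, Exp.nren_open hf₂, h_ren] at hi
        refine hi.tick (consistent_single hyx) (potOk_input hΔ' _)
          (.add (potOk_phi (.sum A p B r) (.con (T := ![ty A, ty B]) (m := ![0, 0]) (1 : Fin 2)
            (.var List.mem_cons_self) fun j => j.elim0))
            (potOk_input (List.Subset.trans hm.2 (List.subset_cons_self _ _)) _))
          (potOk_output _ _ _ _) (potOk_output _ _ _ _) (fun ρ => ?_) (fun ρ => ?_)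
        all_goals
          simp [ctxPot, eval_phi, Tm.eval, phiVal, Val.fold]
          linarith
  | @matchList Γ q q' s₀ s₁ p e₀ e₁ A B x x₁ x₂ hx hx₁ hx₂ hx₁₂ hf₁ hf₂ hq₀ _ hq₁ _ ih₀ ih₁ =>
    simp only [Exp.nren, Var.nren, h]
    have hm : (θ x, ty (.list p A)) ∈ Δ ∧ pureCtx (renCtx θ Γ) ⊆ Δ := by
      simpa [renCtx, pureCtx] using hΔ
    have hcase := hasTy_case (C := .list p A) (T := ![.unit, ty A]) (m := ![0, 1]) (B := B)
      (e := ![.tick K.cCaseNil ((h K (e₀.nren θ)).ren fun n => .bound (n + 1)),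
        .tick K.cCaseCons (h K (e₁.nren θ))])
      (g := (Pot.const (q' : R)).add (phi B (.name y))) (y := y) rfl hm.1
      (potOk_input hm.2 q) (fun z hz => ?_) (fun ρ => ?_) (fun i x₀ xr hnd hfr => ?_)
    · refine hcase.conseq (consistent_single hy) (.add (potOk_phi_name hm.1) (potOk_input hm.2 _))
        (potOk_input hΔ _) (potOk_output _ _ _ _) (potOk_output _ _ _ _) (fun ρ => ?_) (fun ρ => ?_)
      all_goals
        simp only [Pot.eval_add, Pot.eval_const, renCtx, List.map_cons, ctxPot]
        linarith
    · have := ctxPot_fv (Γ := renCtx θ Γ) (x := z) (by simpa [Pot.add, Pot.fv] using hz)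
      exact List.mem_toFinset.2 (dom_mono hm.2 (by simpa [pureCtx, dom] using this))
    · exact add_nonneg (eval_ctxPot_nonneg _ _) q.2
    · have hfr₀ := hfr x₀ (by simp)
      fin_cases i
      · have hyx := notMem_dom_cons (t := (ty .unit : AmorNA.Ty R)) (Ne.symm hfr₀.2) hy
        have hΔ' : pureCtx (renCtx θ Γ) ⊆ (x₀, ty .unit) :: Δ :=
          List.Subset.trans hm.2 (List.subset_cons_self _ _)
        have hi := ih₀ θ hΔ' (closed_cons hc x₀ .unit) hyx
        -- The unit content of `nil` is an unused variable of the context; opening the shifted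
        -- branch gives back the branch.
        rw [← Tm.open_weaken (h K (e₀.nren θ)) x₀] at hi
        refine hi.tick (consistent_single hyx) (potOk_input hΔ' _)
          (.add (potOk_phi (.list p A) (.con (T := ![.unit, ty A]) (m := ![0, 1]) (0 : Fin 2)
            (.var List.mem_cons_self) fun j => j.elim0)) (potOk_input hΔ' _))
          (potOk_output _ _ _ _) (potOk_output _ _ _ _) (fun ρ => ?_) (fun ρ => ?_)
        all_goals
          simp [eval_phi, Tm.eval, phiVal, Val.fold]
          linarith
      · have hfr₁ := hfr (xr (0 : Fin 1)) (List.mem_cons_of_mem _ (List.mem_ofFn.2 ⟨_, rfl⟩))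
        have hyx := notMem_dom_cons (t := ty A) (Ne.symm hfr₀.2)
          (notMem_dom_cons (t := ty (.list p A)) (Ne.symm hfr₁.2) hy)
        have hr := renCtx_cons_update₂ (θ := θ) (y₁ := x₀) (y₂ := xr (0 : Fin 1)) (A₁ := A)
          (A₂ := .list p A) hx₁₂ hx₁ hx₂
        have hΔ' : pureCtx ((x₀, A) :: (xr (0 : Fin 1), .list p A) :: renCtx θ Γ) ⊆
            (x₀, ty A) :: (xr (0 : Fin 1), ty (.list p A)) :: Δ :=
          List.cons_subset_cons _ (List.cons_subset_cons _ hm.2)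
        have hi := ih₁ (Function.update (Function.update θ x₁ x₀) x₂ (xr (0 : Fin 1))) (by rwa [hr])
          (closed_cons (closed_cons hc _ (.list p A)) x₀ A) hyx
        rw [hr, Exp.nren_open₂ hx₁₂ hf₁ hf₂, h_ren] at hi
        refine hi.tick
          (F := (phi (.list p A) (.con 1 (.name x₀) 1 fun j => .name (xr j))).add
            ((ctxPot (renCtx θ Γ)).add (.const q)))
          (consistent_single hyx) (potOk_input hΔ' _)
          (.add (potOk_phi (.list p A) (.con (T := ![.unit, ty A]) (m := ![0, 1]) (1 : Fin 2)
            (.var List.mem_cons_self) fun j => .var ?_))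
            (potOk_input (List.Subset.trans hm.2 (List.Subset.trans (List.subset_cons_self _ _)
              (List.subset_cons_self _ _))) _))
          (potOk_output _ _ _ _) (potOk_output _ _ _ _) (fun ρ => ?_) (fun ρ => ?_)
        · obtain rfl : j = (0 : Fin 1) := Subsingleton.elim (α := Fin 1) _ _
          exact List.mem_cons_of_mem _ List.mem_cons_self
        all_goals
          have he := phiVal_cons p A (ρ x₀) (fun j => ρ (xr j))
          simp only [Pot.eval_add, Pot.eval_const, ctxPot, eval_phi, Tm.eval, he]
          linarith

end Embedding

end AARA

/-! ### The theorem, from the induction with the identity renaming -/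

theorem mainTheorem3 {R : Type*} [CommRing R] [LinearOrder R] [IsStrictOrderedRing R]
    (K : AARA.Costs R) {Γ : AARA.Ctx R} {p q : AmorNA.NN R} {e : AARA.Exp R} {A : AARA.Ty R}
    (hD : AARA.Judg K Γ p q e A) (x : ℕ) (hx : x ∉ AmorNA.dom Γ) :
    ∃ Φ' : AmorNA.Pot R,
      AmorNA.PotLe [(x, AARA.ty A)] (AARA.pureCtx Γ)
        (AmorNA.Pot.add (.const q) (AARA.phi A (.name x))) Φ' ∧
      AmorNA.HasTy [] (AARA.pureCtx Γ) (AmorNA.Pot.add (AARA.ctxPot Γ) (.const p))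
        (AARA.h K e) x Φ' (AARA.ty A) := by
  have hΓ : AARA.renCtx id Γ = Γ := List.map_id _
  have hxΓ : x ∉ AmorNA.dom (AARA.pureCtx Γ) := by
    simpa [AARA.pureCtx, AmorNA.dom] using hx
  have hE := AARA.embedding hD id (Δ := AARA.pureCtx Γ) (by rw [hΓ]; exact fun _ h => h)
    (fun b hb => by
      obtain ⟨c, _, rfl⟩ := List.mem_map.1 hb
      exact AARA.ty_fv c.2) hxΓ
  rw [hΓ, AARA.Exp.nren_id] at hE
  have wf : AmorNA.PotWf [(x, AARA.ty A)] (AARA.pureCtx Γ)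
      (AmorNA.Pot.add (.const q) (AARA.phi A (.name x))) :=
    ⟨AmorNA.consistent_single hxΓ, AARA.potOk_output A x _ q⟩
  -- The witness is `q + Φ_x(A)` itself.
  exact ⟨_, ⟨wf, wf, fun _ _ => le_rfl⟩, hE⟩
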